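/- Notation. For $x\in M_d(\mathbb C)$ let $\|x\|_{2,M_d}=\big(\tfrac1d\operatorname{tr}(x^*x)\big)^{1/2}$ be the normalized Hilbert–Schmidt norm, and $U(d)=U(M_d(\mathbb C))$. For a projection $q\in M=M_d(\mathbb C)$, $U(qMq)$ is the set of $u\in qMq$ with $u^*u=uu^*=q$; for $q\neq 0$ the normalized Hilbert–Schmidt norm of $qMq$ is $x\mapsto\|x\|_{2,M}/\|q\|_{2,M}$. "For almost every $n$" means for all but finitely many $n$. A sequence of maps $\rho_n:\Gamma\to U(d_n)$ is an asymptotic representation if $\|\rho_n(gh)-\rho_n(g)\rho_n(h)\|_{2}\to0$ for all $g,h\in\Gamma$. The group $\Gamma$ is Hilbert–Schmidt stable (in the flexible sense) if for every asymptotic representation $\pi_n:\Gamma\to U(d_n)$ there are integers $D_n\ge d_n$ and unitary representations $\rho_n:\Gamma\to U(D_n)$ with $\|(\pi_n(g)\oplus 0_{D_n-d_n})-\rho_n(g)\|_{2,M_{D_n}}\to0$ for every $g\in\Gamma$. The group $\Gamma$ has property (T;FD) if there are a finite symmetric generating set $S_0$ of $\Gamma$ and $\lambda>0$ such that for every finite-dimensional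 unitary representation $\pi$ of $\Gamma$ the spectrum of $1-\frac1{|S_0|}\sum_{s\in S_0}\pi(s)$ does not meet $(0,\lambda)$; in particular $\Gamma$ is finitely generated. A 2-cocycle is a map $c:\Gamma\times\Gamma\to\mathbb T$ to the circle group with $c(g,h)c(gh,k)=c(h,k)c(g,hk)$ for all $g,h,k\in\Gamma$; it is a 2-coboundary if there is $b:\Gamma\to\mathbb T$ with $c(g,h)=b(g)b(h)b(gh)^{-1}$ for all $g,h\in\Gamma$. For projections $q_n\in M_n=M_{d_n}(\mathbb C)$, a sequence of maps $\pi_n:\Gamma\to U(q_nM_nq_n)$ is an asymptotically projective representation with associated 2-cocycle $c$ if $\|\pi_n(g)\pi_n(h)-c(g,h)\pi_n(gh)\|_{2,M_n}/\|q_n\|_{2,M_n}\to0$ for all $g,h\in\Gamma$. Theorem. Let $\Gamma$ be a group generated by a subset $S$, and suppose that $\Gamma$ has property (T;FD) and is Hilbert–Schmidt stable. Then there exists $\epsilon>0$ (depending only on $\Gamma$ and $S$) such that for every sequence $d_n\in\mathbb N$, with $M_n=M_{d_n}(\mathbb C)$, and all projections $q_n\in M_n$ with $\liminf_n\|q_n\|_{2,M_n}>0$,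 the following holds: if $\rho_n:\Gamma\to U(M_n)$ is an asymptotic representation and $\pi_n:\Gamma\to U(q_nM_nq_n)$ is an asymptotically projective representation with associated 2-cocycle $c$, such that for almost every $n$ $$\|\pi_n(s)-q_n\rho_n(s)q_n\|_{2,M_n}/\|q_n\|_{2,M_n}<\epsilon\quad\text{for all }s\in S,$$ then $c$ is a 2-coboundary. -/

import Mathlib

open Filter Topology

namespace HSRigidity

/-- The normalized Hilbert–Schmidt norm `‖x‖₂ = (tr(x* x) / d)^(1/2)` on `M_d(ℂ)`
(it is `0` on the zero ring `M_0(ℂ)`). -/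
noncomputable def hsNorm {d : ℕ} (x : Matrix (Fin d) (Fin d) ℂ) : ℝ :=
  Real.sqrt ((1 / (d : ℝ)) * (Matrix.trace (star x * x)).re)

/-- The matrix `x ⊕ 0` of size `m`, for `x` of size `n ≤ m`. -/
def zeroPad {n : ℕ} (m : ℕ) (x : Matrix (Fin n) (Fin n) ℂ) : Matrix (Fin m) (Fin m) ℂ :=
  fun i j => if h : i.val < n ∧ j.val < n then x ⟨i.val, h.1⟩ ⟨j.val, h.2⟩ else 0

/-- The generalized Hilbert–Schmidt distance `d₂(x, y) = ‖x ⊕ 0 - y‖_{2,m}` between matrices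
of sizes `n ≤ m`. -/
noncomputable def hsDist {n m : ℕ} (x : Matrix (Fin n) (Fin n) ℂ)
    (y : Matrix (Fin m) (Fin m) ℂ) : ℝ :=
  hsNorm (zeroPad m x - y)

/-- A sequence of maps `ρ n : Γ → U(d n)` is an asymptotic representation if
`‖ρ n (g h) - ρ n g * ρ n h‖₂ → 0` for all `g h`. -/
def IsAsymptoticRep {Γ : Type*} [Group Γ] {d : ℕ → ℕ}
    (ρ : (n : ℕ) → Γ → Matrix.unitaryGroup (Fin (d n)) ℂ) : Prop :=
  ∀ g h : Γ, Tendsto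
    (fun n => hsNorm ((ρ n (g * h) : Matrix (Fin (d n)) (Fin (d n)) ℂ)
      - (ρ n g : Matrix (Fin (d n)) (Fin (d n)) ℂ) * (ρ n h : Matrix (Fin (d n)) (Fin (d n)) ℂ)))
    atTop (𝓝 0)

/-- (Flexible) Hilbert–Schmidt stability: every asymptotic representation is pointwise
asymptotically `d₂`-close to a sequence of genuine unitary representations, possibly of
larger dimensions. -/
def IsHilbertSchmidtStable (Γ : Type*) [Group Γ] : Prop :=
  ∀ (d : ℕ → ℕ) (π : (n : ℕ) → Γ → Matrix.unitaryGroup (Fin (d n)) ℂ), IsAsymptoticRep π →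
    ∃ (D : ℕ → ℕ) (ρ : (n : ℕ) → Γ →* Matrix.unitaryGroup (Fin (D n)) ℂ),
      (∀ n, d n ≤ D n) ∧
      ∀ g : Γ, Tendsto
        (fun n => hsDist (π n g : Matrix (Fin (d n)) (Fin (d n)) ℂ)
          (ρ n g : Matrix (Fin (D n)) (Fin (D n)) ℂ))
        atTop (𝓝 0)

/-- The image `π(Δ_S) = 1 - |S|⁻¹ ∑_{s ∈ S} π(s)` of the normalized combinatorial Laplacian. -/
noncomputable def laplacian {Γ : Type*} [Group Γ] (S : Finset Γ) {d : ℕ}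
    (π : Γ →* Matrix.unitaryGroup (Fin d) ℂ) : Matrix (Fin d) (Fin d) ℂ :=
  1 - ((S.card : ℂ)⁻¹) • ∑ s ∈ S, (π s : Matrix (Fin d) (Fin d) ℂ)

/-- Property (T;FD): for some finite symmetric generating set `S` and some `lam > 0`, the
(self-adjoint, positive) operators `π(Δ_S)` have no spectrum in `(0, lam)`, for all
finite-dimensional unitary representations `π`. In particular, the group is finitely
generated. -/
def HasPropertyTFD (Γ : Type*) [Group Γ] : Prop :=
  ∃ S : Finset Γ, (∀ s ∈ S, s⁻¹ ∈ S) ∧ Subgroup.closure (S : Set Γ) = ⊤ ∧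
    ∃ lam : ℝ, 0 < lam ∧
      ∀ (d : ℕ) (π : Γ →* Matrix.unitaryGroup (Fin d) ℂ),
        spectrum ℝ (laplacian S π) ∩ Set.Ioo 0 lam = ∅

/-- The unitary group `U(q M_d(ℂ) q)` of the corner of `M_d(ℂ)` at a projection `q`, whose
unit is `q`, as a set of matrices. -/
def cornerUnitary {d : ℕ} (q : Matrix (Fin d) (Fin d) ℂ) : Set (Matrix (Fin d) (Fin d) ℂ) :=
  {u | q * u * q = u ∧ star u * u = q ∧ u * star u = q}

/-- The normalized Hilbert–Schmidt norm of the corner `q M_d(ℂ) q` at a projection `q`. -/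
noncomputable def cornerNorm {d : ℕ} (q x : Matrix (Fin d) (Fin d) ℂ) : ℝ :=
  hsNorm x / hsNorm q

/-- `c` is a 2-cocycle of `Γ` with values in the circle, with the trivial action. -/
def IsTwoCocycle {Γ : Type*} [Group Γ] (c : Γ → Γ → Circle) : Prop :=
  ∀ g h k : Γ, c g h * c (g * h) k = c h k * c g (h * k)

/-- `c` is the 2-coboundary of a function from `Γ` to the circle, with the trivial action. -/
def IsTwoCoboundary {Γ : Type*} [Group Γ] (c : Γ → Γ → Circle) : Prop :=
  ∃ b : Γ → Circle, ∀ g h : Γ, c g h = b g * b h * (b (g * h))⁻¹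

/-- A sequence of maps `π n : Γ → U(q_n M_{d_n}(ℂ) q_n)` is an asymptotically projective
representation with associated 2-cocycle `c`. -/
structure IsAsymptoticallyProjectiveRep {Γ : Type*} [Group Γ] {d : ℕ → ℕ}
    (q : (n : ℕ) → Matrix (Fin (d n)) (Fin (d n)) ℂ)
    (π : (n : ℕ) → Γ → Matrix (Fin (d n)) (Fin (d n)) ℂ) (c : Γ → Γ → Circle) : Prop where
  mem_cornerUnitary : ∀ n g, π n g ∈ cornerUnitary (q n)
  isTwoCocycle : IsTwoCocycle c
  tendsto : ∀ g h : Γ, Tendsto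
    (fun n => cornerNorm (q n) (π n g * π n h - (c g h : ℂ) • π n (g * h))) atTop (𝓝 0)

end HSRigidity

/-! If `c` were trivial, `x ↦ π(g) x ρ(g)ᴴ` would be close to an honest action. In general it is
only projective, and a line `ℂξ` almost invariant under it already suffices: if `π(g) ξ ρ(g)ᴴ ≈ b(g)
ξ`, then `b(g) b(h) ≈ c(g,h) b(gh)`, and a limit of `b` trivialises `c`. The task is to find such a
line from closeness on generators alone.

Neither stability nor the spectral gap applies to a projective object, so everything is doubled. In
`π ⊗ π̄` the cocycle cancels. Extended by the identity off `Q = q ⊗ q̄`, it is an asymptotic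
representation, and so is `ρ ⊗ ρ̄`. By `IsHilbertSchmidtStable.exists_approx` both are near
compressions of genuine representations `α'`, `β'`. Since `π(s) ≈ q ρ(s)` on generators, `Q`,
transported by the isometries, is almost fixed by `x ↦ α'(g) x β'(g)ᴴ`. The gap
(`exists_fixed_near`) then gives a fixed vector near it, and `exists_almost_intertwiner` compresses
this back to some `y` with `‖y - Q‖ ≤ ‖q‖² / 8` that almost intertwines for every `g`, with error
tending to zero along the sequence.

To undo the doubling, `realign` reads a matrix on `ℂᵈ ⊗ ℂᵈ` as an operator on `M_d`. There `Q`
becomes a multiple of the rank-one projection onto `q`, so the realigned `Q y` has a form with one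
dominant direction `ξ` (`exists_almost_maximizers_unique`). Almost-intertwining says the form is
almost invariant under `x ↦ π(g) x ρ(g)ᴴ`, so the image of `ξ` nearly maximises it and is nearly a
multiple of `ξ` (`exists_almost_invariant_line`). Multiplicativity of `b` up to `c` is obtained by
pairing with `q` (`norm_mul_sub_mul_inner_le`). -/

namespace HSRigidity

open Matrix Kronecker ComplexConjugate

attribute [local instance] Matrix.frobeniusNormedAddCommGroup Matrix.frobeniusNormedSpace

/-! ### Algebra of `a ⊗ b̄`. -/

section ConjKronecker

variable {l m n : Type*}

/-- The tensor `a ⊗ b̄`. -/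
noncomputable def conjKronecker (a b : Matrix m n ℂ) : Matrix (m × m) (n × n) ℂ :=
  a ⊗ₖ b.map conj

theorem conjKronecker_mul [Fintype m] (a b : Matrix l m ℂ) (a' b' : Matrix m n ℂ) :
    conjKronecker (a * a') (b * b') = conjKronecker a b * conjKronecker a' b' := by
  simp only [conjKronecker, Matrix.map_mul, mul_kronecker_mul]

theorem conjTranspose_conjKronecker (a b : Matrix m n ℂ) :
    (conjKronecker a b)ᴴ = conjKronecker aᴴ bᴴ := by
  ext ⟨i, j⟩ ⟨i', j'⟩
  simp [conjKronecker]

theorem conjKronecker_one [DecidableEq m] :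
    conjKronecker (1 : Matrix m m ℂ) 1 = 1 := by
  rw [conjKronecker, Matrix.map_one _ (by simp) (by simp), one_kronecker_one]

theorem conjKronecker_smul (r s : ℂ) (a b : Matrix m n ℂ) :
    conjKronecker (r • a) (s • b) = (r * conj s) • conjKronecker a b := by
  ext ⟨i, j⟩ ⟨i', j'⟩
  simp [conjKronecker]
  ring

theorem conjKronecker_sub_sub (a b : Matrix m n ℂ) :
    conjKronecker a a - conjKronecker b b
      = conjKronecker (a - b) a + conjKronecker b (a - b) := by
  ext ⟨i, j⟩ ⟨i', j'⟩
  simp [conjKronecker]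
  ring

end ConjKronecker

/-! ### The Hilbert–Schmidt inner product and unnormalised norm estimates. -/

section Frobenius

variable {l m n k : Type*} [Fintype l] [Fintype m] [Fintype n] [Fintype k]

theorem frobenius_norm_sq (x : Matrix m n ℂ) : ‖x‖ ^ 2 = ∑ i, ∑ j, ‖x i j‖ ^ 2 := by
  rw [Matrix.frobenius_norm_def, ← Real.sqrt_eq_rpow, Real.sq_sqrt (by positivity)]
  simp

theorem re_trace_conjTranspose_mul_self (x : Matrix m n ℂ) :
    (trace (xᴴ * x)).re = ‖x‖ ^ 2 := by
  rw [frobenius_norm_sq, Finset.sum_comm]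
  simp only [trace, diag, mul_apply, conjTranspose_apply, Complex.re_sum]
  refine Finset.sum_congr rfl fun i _ => Finset.sum_congr rfl fun j _ => ?_
  rw [Complex.star_def, ← Complex.normSq_eq_conj_mul_self, Complex.ofReal_re,
    Complex.normSq_eq_norm_sq]

/-- The Hilbert–Schmidt inner product `⟪x, y⟫ = tr(xᴴ y)` on rectangular matrices, which induces
the Frobenius norm. -/
@[reducible]
noncomputable def frobeniusInnerProductSpace : InnerProductSpace ℂ (Matrix m n ℂ) :=
  { (Matrix.frobeniusNormedSpace : NormedSpace ℂ (Matrix m n ℂ)) with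
    inner := fun x y => trace (xᴴ * y)
    norm_sq_eq_re_inner := fun x => (re_trace_conjTranspose_mul_self x).symm
    conj_inner_symm := fun x y => by
      rw [starRingEnd_apply, ← trace_conjTranspose]
      simp
    add_left := fun x y z => by simp [Matrix.add_mul]
    smul_left := fun x y r => by simp }

attribute [local instance] frobeniusInnerProductSpace

theorem inner_eq_trace (x y : Matrix m n ℂ) : inner ℂ x y = trace (xᴴ * y) := rfl

theorem inner_mul_left_eq (a : Matrix l m ℂ) (x : Matrix m n ℂ) (y : Matrix l n ℂ) :
    inner ℂ (a * x) y = inner ℂ x (aᴴ * y) := by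
  simp [inner_eq_trace, Matrix.mul_assoc]

theorem inner_mul_right_eq (x : Matrix m n ℂ) (a : Matrix n k ℂ) (y : Matrix m k ℂ) :
    inner ℂ (x * a) y = inner ℂ x (y * aᴴ) := by
  rw [inner_eq_trace, inner_eq_trace, conjTranspose_mul, Matrix.mul_assoc aᴴ,
    trace_mul_comm aᴴ, Matrix.mul_assoc xᴴ]

theorem norm_isometry_mul [DecidableEq m] {w : Matrix l m ℂ} (hw : wᴴ * w = 1)
    (x : Matrix m n ℂ) : ‖w * x‖ = ‖x‖ := by
  have h : ‖w * x‖ ^ 2 = ‖x‖ ^ 2 := by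
    rw [← re_trace_conjTranspose_mul_self, ← re_trace_conjTranspose_mul_self,
      conjTranspose_mul, Matrix.mul_assoc, ← Matrix.mul_assoc wᴴ, hw, Matrix.one_mul]
  exact (sq_eq_sq₀ (norm_nonneg _) (norm_nonneg _)).1 h

theorem norm_mul_coisometry [DecidableEq m] {w : Matrix m l ℂ} (hw : w * wᴴ = 1)
    (x : Matrix n m ℂ) : ‖x * w‖ = ‖x‖ := by
  rw [← frobenius_norm_conjTranspose, conjTranspose_mul,
    norm_isometry_mul (by simpa using hw), frobenius_norm_conjTranspose]

/-- Since `q = qᴴ q`, `‖q x‖² = Re ⟪q x, x⟫`; Cauchy–Schwarz does the rest. -/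
theorem norm_projection_mul_le {q : Matrix m m ℂ} (hq : IsStarProjection q)
    (x : Matrix m n ℂ) : ‖q * x‖ ≤ ‖x‖ := by
  have hs : qᴴ = q := hq.isSelfAdjoint
  have hi : q * q = q := hq.isIdempotentElem
  have h : ‖q * x‖ ^ 2 ≤ ‖q * x‖ * ‖x‖ := by
    have h1 : ‖q * x‖ ^ 2 = (inner ℂ (q * x) x).re := by
      rw [← re_trace_conjTranspose_mul_self, inner_eq_trace, conjTranspose_mul, hs,
        Matrix.mul_assoc, ← Matrix.mul_assoc q, hi, Matrix.mul_assoc]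
    rw [h1]
    exact (Complex.re_le_norm _).trans (norm_inner_le_norm _ _)
  by_contra! hlt
  nlinarith [norm_nonneg x, norm_nonneg (q * x)]

theorem norm_mul_projection_le {q : Matrix m m ℂ} (hq : IsStarProjection q)
    (x : Matrix n m ℂ) : ‖x * q‖ ≤ ‖x‖ := by
  have hs : qᴴ = q := hq.isSelfAdjoint
  rw [← frobenius_norm_conjTranspose, conjTranspose_mul, hs, ← frobenius_norm_conjTranspose x]
  exact norm_projection_mul_le hq _

theorem norm_coisometry_mul_le [DecidableEq m] {w : Matrix l m ℂ} (hw : wᴴ * w = 1)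
    (x : Matrix l n ℂ) : ‖wᴴ * x‖ ≤ ‖x‖ := by
  rw [← norm_isometry_mul hw, ← Matrix.mul_assoc]
  refine norm_projection_mul_le ⟨?_, ?_⟩ x
  · rw [IsIdempotentElem, Matrix.mul_assoc, ← Matrix.mul_assoc wᴴ, hw, Matrix.one_mul]
  · rw [IsSelfAdjoint, star_eq_conjTranspose, conjTranspose_mul, conjTranspose_conjTranspose]

theorem norm_mul_isometry_le [DecidableEq m] {w : Matrix l m ℂ} (hw : wᴴ * w = 1)
    (x : Matrix n l ℂ) : ‖x * w‖ ≤ ‖x‖ := by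
  rw [← frobenius_norm_conjTranspose, conjTranspose_mul, ← frobenius_norm_conjTranspose x]
  exact norm_coisometry_mul_le hw _

theorem norm_kronecker (a : Matrix l m ℂ) (b : Matrix n k ℂ) : ‖a ⊗ₖ b‖ = ‖a‖ * ‖b‖ := by
  have h : ‖a ⊗ₖ b‖ ^ 2 = (‖a‖ * ‖b‖) ^ 2 := by
    rw [mul_pow, frobenius_norm_sq, frobenius_norm_sq, frobenius_norm_sq]
    simp only [Fintype.sum_prod_type, kroneckerMap_apply, norm_mul, mul_pow]
    simp only [Finset.sum_mul_sum]
  exact (sq_eq_sq₀ (norm_nonneg _) (by positivity)).1 h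

theorem norm_map_conj (a : Matrix m n ℂ) : ‖a.map conj‖ = ‖a‖ :=
  frobenius_norm_map_eq a _ fun z => by simp

theorem norm_conjKronecker (a b : Matrix m n ℂ) : ‖conjKronecker a b‖ = ‖a‖ * ‖b‖ := by
  rw [conjKronecker, norm_kronecker, norm_map_conj]

theorem norm_conjKronecker_sub_le (a b : Matrix m n ℂ) :
    ‖conjKronecker a a - conjKronecker b b‖ ≤ ‖a - b‖ * (‖a‖ + ‖b‖) := by
  rw [conjKronecker_sub_sub]
  refine (norm_add_le _ _).trans ?_
  rw [norm_conjKronecker, norm_conjKronecker]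
  exact le_of_eq (by ring)

theorem isStarProjection_conjKronecker {q : Matrix m m ℂ} (hq : IsStarProjection q) :
    IsStarProjection (conjKronecker q q) := by
  have hs : qᴴ = q := hq.isSelfAdjoint
  have hi : q * q = q := hq.isIdempotentElem
  refine ⟨?_, ?_⟩
  · rw [IsIdempotentElem, ← conjKronecker_mul, hi]
  · rw [IsSelfAdjoint, star_eq_conjTranspose, conjTranspose_conjKronecker, hs]

theorem inner_conjKronecker (a b c d : Matrix m n ℂ) :
    inner ℂ (conjKronecker a b) (conjKronecker c d) = inner ℂ a c * conj (inner ℂ b d) := by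
  rw [inner_eq_trace, conjTranspose_conjKronecker, ← conjKronecker_mul, conjKronecker,
    trace_kronecker, inner_eq_trace, inner_eq_trace]
  rw [AddMonoidHom.map_trace (starRingEnd ℂ)]

end Frobenius

attribute [local instance] frobeniusInnerProductSpace

theorem hsNorm_eq {d : ℕ} (x : Matrix (Fin d) (Fin d) ℂ) : hsNorm x = ‖x‖ / Real.sqrt d := by
  rw [hsNorm, star_eq_conjTranspose, re_trace_conjTranspose_mul_self,
    Real.sqrt_mul (by positivity), Real.sqrt_sq (norm_nonneg _), one_div, Real.sqrt_inv]
  ring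

/-- The isometric embedding of `ℂⁿ` as the first `n` coordinates of `ℂᵐ`, for `n ≤ m`. -/
noncomputable def padIsometry (m n : ℕ) : Matrix (Fin m) (Fin n) ℂ :=
  Matrix.of fun i j => if i.val = j.val then 1 else 0

theorem padIsometry_conjTranspose_mul {m n : ℕ} (h : n ≤ m) :
    (padIsometry m n)ᴴ * padIsometry m n = 1 := by
  ext i j
  rw [mul_apply, Finset.sum_eq_single (Fin.castLE h i)]
  · simp [padIsometry, one_apply, Fin.ext_iff]
  · intro b _ hb
    have : b.val ≠ i.val := fun hh => hb (Fin.ext hh)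
    simp [padIsometry, this]
  · simp

/-- This form lets stability be used through isometries `V` and products `V x Vᴴ` instead of
coordinates. -/
theorem zeroPad_eq {m n : ℕ} (x : Matrix (Fin n) (Fin n) ℂ) :
    zeroPad m x = padIsometry m n * x * (padIsometry m n)ᴴ := by
  ext i j
  have key : ∀ (i : Fin m) (f : Fin n → ℂ), ∑ k : Fin n, (if i.val = k.val then 1 else 0) * f k
      = if h : i.val < n then f ⟨i, h⟩ else 0 := by
    intro i f
    split_ifs with h
    · rw [Finset.sum_eq_single ⟨i, h⟩]
      · simp
      · intro b _ hb
        rw [if_neg fun hh => hb (Fin.ext hh.symm), zero_mul]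
      · simp
    · refine Finset.sum_eq_zero fun k _ => ?_
      rw [if_neg (by omega), zero_mul]
  rw [Matrix.mul_assoc, mul_apply]
  simp only [padIsometry, of_apply, mul_apply, conjTranspose_apply, zeroPad]
  rw [key]
  have : ∀ k, ∑ y, x k y * star (if j.val = y.val then (1:ℂ) else 0)
      = ∑ y, (if j.val = y.val then 1 else 0) * x k y := fun k =>
    Finset.sum_congr rfl fun y _ => by split_ifs <;> simp
  simp only [this, key]
  by_cases h1 : i.val < n <;> by_cases h2 : j.val < n <;> simp [h1, h2]

/-! ### Unitary actions: displacement, fixed vectors, Laplacian. -/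

section UnitaryActions

variable {Γ : Type*} [Group Γ] {E : Type*} [NormedAddCommGroup E] [InnerProductSpace ℂ E]

theorem re_inner_sub_isometry (u : E ≃ₗᵢ[ℂ] E) (x : E) :
    (inner ℂ (x - u x) x).re = ‖u x - x‖ ^ 2 / 2 := by
  have h := @norm_sub_sq ℂ E _ _ _ (u x) x
  rw [inner_sub_left, Complex.sub_re]
  have h2 : (inner ℂ x x).re = ‖x‖ ^ 2 := inner_self_eq_norm_sq (𝕜 := ℂ) x
  rw [h2, h, LinearIsometryEquiv.norm_map]
  simp
  ring

theorem fixed_of_closure_eq_top {S : Set Γ} (hS : Subgroup.closure S = ⊤)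
    (U : Γ →* (E ≃ₗᵢ[ℂ] E)) {x : E} (h : ∀ s ∈ S, U s x = x) (g : Γ) : U g x = x := by
  have hg : g ∈ Subgroup.closure S := hS ▸ Subgroup.mem_top g
  induction hg using Subgroup.closure_induction with
  | mem s hs => exact h s hs
  | one => simp
  | mul a b _ _ ha hb => rw [map_mul, LinearIsometryEquiv.coe_mul, Function.comp_apply, hb, ha]
  | inv a _ ha =>
    conv_lhs => rw [← ha]
    rw [← Function.comp_apply (f := U a⁻¹), ← LinearIsometryEquiv.coe_mul, ← map_mul]
    simp

/-- The displacement of vectors by an element of the group generated by `S` is controlled by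
finitely many displacements by elements of `S`, uniformly over all unitary actions. -/
theorem exists_displacement_bound {S : Set Γ} (hS : Subgroup.closure S = ⊤) (g : Γ) :
    ∃ K : ℝ, 0 < K ∧ ∃ F : Finset Γ, (F : Set Γ) ⊆ S ∧
      ∀ (E : Type) [NormedAddCommGroup E] [InnerProductSpace ℂ E] (U : Γ →* (E ≃ₗᵢ[ℂ] E))
        (x : E) (δ : ℝ), 0 ≤ δ → (∀ s ∈ F, ‖U s x - x‖ ≤ δ) → ‖U g x - x‖ ≤ K * δ := by
  classical
  have hg : g ∈ Subgroup.closure S := hS ▸ Subgroup.mem_top g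
  induction hg using Subgroup.closure_induction with
  | mem s hs =>
    exact ⟨1, one_pos, {s}, by simpa using hs, fun E _ _ U x δ _ h => by
      simpa using h s (by simp)⟩
  | one => exact ⟨1, one_pos, ∅, by simp, fun E _ _ U x δ h _ => by simpa using h⟩
  | mul a b _ _ ha hb =>
    obtain ⟨K, hK, F, hF, h⟩ := ha
    obtain ⟨K', hK', F', hF', h'⟩ := hb
    refine ⟨K + K', by positivity, F ∪ F', by simp [hF, hF'], fun E _ _ U x δ hδ hx => ?_⟩
    have h1 := h E U x δ hδ fun s hs => hx s (by simp [hs])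
    have h2 := h' E U x δ hδ fun s hs => hx s (by simp [hs])
    have h3 : U (a * b) x - x = U a (U b x - x) + (U a x - x) := by
      simp [map_mul, map_sub]
    rw [h3]
    refine (norm_add_le _ _).trans ?_
    rw [LinearIsometryEquiv.norm_map]
    linarith
  | inv a _ ha =>
    obtain ⟨K, hK, F, hF, h⟩ := ha
    refine ⟨K, hK, F, hF, fun E _ _ U x δ hδ hx => ?_⟩
    have h1 := h E U x δ hδ hx
    rw [← LinearIsometryEquiv.norm_map (U a), map_sub, norm_sub_rev]
    have h3 : U a (U a⁻¹ x) = x := by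
      rw [← Function.comp_apply (f := U a), ← LinearIsometryEquiv.coe_mul, ← map_mul]
      simp
    rwa [h3]

/-- Passes from the arbitrary, possibly infinite, generating set `S` to the finite set carrying the
spectral gap. `K` is chosen before any action, which is why the final `ε` depends only on `Γ` and
`S`. -/
theorem exists_uniform_displacement_bound {S : Set Γ} (hS : Subgroup.closure S = ⊤)
    (T : Finset Γ) :
    ∃ K : ℝ, 0 < K ∧ ∃ F : Finset Γ, (F : Set Γ) ⊆ S ∧
      ∀ (E : Type) [NormedAddCommGroup E] [InnerProductSpace ℂ E] (U : Γ →* (E ≃ₗᵢ[ℂ] E))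
        (x : E) (δ : ℝ), 0 ≤ δ → (∀ s ∈ F, ‖U s x - x‖ ≤ δ) →
          ∀ t ∈ T, ‖U t x - x‖ ≤ K * δ := by
  classical
  choose K hK F hF h using exists_displacement_bound (Γ := Γ) hS
  refine ⟨1 + ∑ t ∈ T, K t, by have := Finset.sum_nonneg fun t (_ : t ∈ T) => (hK t).le; linarith,
    T.biUnion F, ?_, fun E _ _ U x δ hδ hx t ht => ?_⟩
  · simpa using fun t _ => hF t
  · refine (h t E U x δ hδ fun s hs => hx s (Finset.mem_biUnion.2 ⟨t, ht, hs⟩)).trans ?_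
    have := Finset.single_le_sum (f := K) (fun t _ => (hK t).le) ht
    gcongr
    linarith

/-- A fixed vector close to a closed convex invariant set can be moved into the set. -/
theorem exists_fixed_mem_of_fixed [FiniteDimensional ℂ E] (U : Γ →* (E ≃ₗᵢ[ℂ] E)) {K : Set E}
    (hKc : IsClosed K) (hKm : ∀ a ∈ K, ∀ b ∈ K, (1 / 2 : ℂ) • (a + b) ∈ K)
    (hKU : ∀ g, ∀ a ∈ K, U g a ∈ K) {x y : E} (hx : x ∈ K) (hy : ∀ g, U g y = y) :
    ∃ z ∈ K, (∀ g, U g z = z) ∧ ‖x - z‖ ≤ 2 * ‖x - y‖ := by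
  have : ProperSpace E := FiniteDimensional.proper ℂ E
  -- Take a point of `K` nearest to `y`. Each `U g z` is equally near, so the parallelogram law
  -- applied to the midpoint forces `U g z = z`.
  obtain ⟨z, hz, hzd⟩ := hKc.exists_infDist_eq_dist ⟨x, hx⟩ y
  have hmin : ∀ a ∈ K, ‖y - z‖ ≤ ‖y - a‖ := fun a ha => by
    rw [← dist_eq_norm, ← dist_eq_norm, ← hzd]
    exact Metric.infDist_le_dist_of_mem ha
  refine ⟨z, hz, fun g => ?_, ?_⟩
  · have h1 : ‖y - U g z‖ = ‖y - z‖ := by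
      conv_lhs => rw [← hy g, ← map_sub, LinearIsometryEquiv.norm_map]
    have h2 := hmin _ (hKm _ (hKU g z hz) _ hz)
    have h3 := parallelogram_law_with_norm ℂ (y - U g z) (y - z)
    have h4 : y - U g z + (y - z) = (2 : ℂ) • (y - (1 / 2 : ℂ) • (U g z + z)) := by
      module
    have h5 : y - U g z - (y - z) = z - U g z := by abel
    rw [h4, h5, norm_smul, h1] at h3
    have h6 : ‖(2 : ℂ)‖ = 2 := by simp
    rw [h6] at h3
    have h7 : ‖z - U g z‖ * ‖z - U g z‖ ≤ 0 := by
      nlinarith [norm_nonneg (y - z)]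
    have h8 : ‖z - U g z‖ = 0 := by nlinarith [norm_nonneg (z - U g z)]
    exact (sub_eq_zero.1 (norm_eq_zero.1 h8)).symm
  · have h1 := hmin x hx
    have h2 : x - z = (x - y) + (y - z) := by abel
    rw [h2]
    refine (norm_add_le _ _).trans ?_
    rw [norm_sub_rev y x] at h1
    linarith

/-- The Laplacian of a unitary action. -/
noncomputable def actionLaplacian (S : Finset Γ) (U : Γ →* (E ≃ₗᵢ[ℂ] E)) : E →ₗ[ℂ] E :=
  1 - ((S.card : ℂ)⁻¹) • ∑ s ∈ S, (U s).toLinearEquiv.toLinearMap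

theorem actionLaplacian_apply {S : Finset Γ} (hS : S.Nonempty) (U : Γ →* (E ≃ₗᵢ[ℂ] E)) (x : E) :
    actionLaplacian S U x = ((S.card : ℂ)⁻¹) • ∑ s ∈ S, (x - U s x) := by
  have : (S.card : ℂ) ≠ 0 := by simpa using hS.ne_empty
  simp [actionLaplacian, smul_sub, Finset.sum_sub_distrib, ← Nat.cast_smul_eq_nsmul ℂ, smul_smul,
    this]

/-- The adjoint of `U s` is `U s⁻¹`, and inversion permutes `S`. -/
theorem isSymmetric_actionLaplacian {S : Finset Γ} (hS : ∀ s ∈ S, s⁻¹ ∈ S)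
    (U : Γ →* (E ≃ₗᵢ[ℂ] E)) : (actionLaplacian S U).IsSymmetric := by
  have key : ∀ s x y, inner ℂ (U s x) y = inner ℂ x (U s⁻¹ y) := fun s x y => by
    rw [map_inv, ← LinearIsometryEquiv.inner_map_map (U s)⁻¹]
    congr 1
    exact (U s).symm_apply_apply x
  intro x y
  simp only [actionLaplacian, LinearMap.sub_apply, inner_sub_left, inner_sub_right,
    LinearMap.smul_apply, LinearMap.sum_apply, Module.End.one_apply, inner_smul_left,
    inner_smul_right, sum_inner, inner_sum]
  congr 1
  simp only [map_inv₀, map_natCast]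
  congr 1
  refine Finset.sum_nbij' (fun s => s⁻¹) (fun s => s⁻¹) (by simpa using hS) (by simpa using hS)
    (by simp) (by simp) fun s _ => key s x y

end UnitaryActions

/-! ### From the spectral gap to fixed vectors. -/

section SpectralGap

variable {Γ : Type*} [Group Γ] {E : Type*} [NormedAddCommGroup E] [InnerProductSpace ℂ E]
  [FiniteDimensional ℂ E]

/-- The unitary matrix of a linear isometric equivalence in an orthonormal basis. -/
noncomputable def matrixRep {d : ℕ} (b : OrthonormalBasis (Fin d) ℂ E)
    (U : Γ →* (E ≃ₗᵢ[ℂ] E)) : Γ →* Matrix.unitaryGroup (Fin d) ℂ where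
  toFun g := ⟨LinearMap.toMatrixOrthonormal b (U g).toLinearEquiv.toLinearMap, by
    rw [Matrix.mem_unitaryGroup_iff', ← map_star, ← map_mul]
    convert map_one (LinearMap.toMatrixOrthonormal b)
    ext x
    refine ext_inner_left ℂ fun y => ?_
    rw [Module.End.mul_apply, LinearMap.star_eq_adjoint, LinearMap.adjoint_inner_right]
    simp⟩
  map_one' := by
    refine Subtype.ext ?_
    exact (congrArg (fun u : E ≃ₗᵢ[ℂ] E => LinearMap.toMatrixOrthonormal b
      u.toLinearEquiv.toLinearMap) (map_one U)).trans (map_one (LinearMap.toMatrixOrthonormal b))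
  map_mul' g h := by
    refine Subtype.ext ?_
    exact (congrArg (fun u : E ≃ₗᵢ[ℂ] E => LinearMap.toMatrixOrthonormal b
      u.toLinearEquiv.toLinearMap) (map_mul U g h)).trans
      (map_mul (LinearMap.toMatrixOrthonormal b) _ _)

theorem toMatrix_actionLaplacian {d : ℕ} (b : OrthonormalBasis (Fin d) ℂ E)
    (S : Finset Γ) (U : Γ →* (E ≃ₗᵢ[ℂ] E)) :
    LinearMap.toMatrixOrthonormal b (actionLaplacian S U) = laplacian S (matrixRep b U) := by
  simp only [actionLaplacian, laplacian, map_sub, map_one, map_smul, map_sum]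
  rfl

/-- A spectral gap for the Laplacian gives fixed vectors near almost fixed vectors. -/
theorem exists_fixed_near {S : Finset Γ} (hS : ∀ s ∈ S, s⁻¹ ∈ S)
    (hgen : Subgroup.closure (S : Set Γ) = ⊤) {lam : ℝ} (hlam : 0 < lam)
    (hgap : ∀ (d : ℕ) (π : Γ →* Matrix.unitaryGroup (Fin d) ℂ),
        spectrum ℝ (laplacian S π) ∩ Set.Ioo 0 lam = ∅)
    (U : Γ →* (E ≃ₗᵢ[ℂ] E)) {x : E} {δ : ℝ} (hδ : 0 ≤ δ) (hx : ∀ s ∈ S, ‖U s x - x‖ ≤ δ) :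
    ∃ y, (∀ g, U g y = y) ∧ ‖x - y‖ ≤ δ / lam := by
  -- With `S` empty every vector is fixed. The averaging formula for the Laplacian used below needs
  -- `S.card ≠ 0`.
  rcases S.eq_empty_or_nonempty with rfl | hne
  · exact ⟨x, fixed_of_closure_eq_top hgen U (by simp), by simpa using by positivity⟩
  have hcard : (0 : ℝ) < S.card := by simpa using hne
  set T := actionLaplacian S U with hT
  have hsym : T.IsSymmetric := isSymmetric_actionLaplacian hS U
  -- The form is a mean of squared displacements: this gives positivity, and identifies the kernel
  -- of `T` with the fixed vectors.
  have hquad : ∀ v, (inner ℂ (T v) v).re = (S.card : ℝ)⁻¹ * ∑ s ∈ S, ‖U s v - v‖ ^ 2 / 2 := by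
    intro v
    rw [hT, actionLaplacian_apply hne, inner_smul_left, sum_inner]
    rw [map_inv₀, map_natCast, ← Complex.ofReal_natCast, ← Complex.ofReal_inv,
      Complex.re_ofReal_mul, Complex.re_sum]
    simp only [re_inner_sub_isometry]
  have hker : ∀ v, T v = 0 → ∀ g, U g v = v := by
    intro v hv
    refine fixed_of_closure_eq_top hgen U fun s hs => ?_
    have h := hquad v
    rw [hv, inner_zero_left, Complex.zero_re, eq_comm, mul_eq_zero] at h
    have h1 := (Finset.sum_eq_zero_iff_of_nonneg fun s _ => by positivity).1
      (h.resolve_left (by positivity)) s hs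
    have h2 : ‖U s v - v‖ = 0 := by nlinarith [norm_nonneg (U s v - v)]
    exact sub_eq_zero.1 (norm_eq_zero.1 h2)
  let b := hsym.eigenvectorBasis rfl
  let μ := hsym.eigenvalues rfl
  have hTb : ∀ i, T (b i) = (μ i : ℂ) • b i := fun i => hsym.apply_eigenvectorBasis rfl i
  have hμ : ∀ i, μ i = 0 ∨ lam ≤ μ i := by
    intro i
    have h0 : 0 ≤ μ i := by
      have h1 := hquad (b i)
      rw [hTb, inner_smul_left, Complex.conj_ofReal, Complex.re_ofReal_mul] at h1
      have h2 : (inner ℂ (b i) (b i)).re = 1 := by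
        simp
      rw [h2, mul_one] at h1
      rw [h1]
      positivity
    by_contra! hcon
    have hmem : μ i ∈ spectrum ℝ (laplacian S (matrixRep b U)) := by
      have h1 : (μ i : ℂ) ∈ spectrum ℂ T :=
        (hsym.hasEigenvalue_eigenvalues rfl i).mem_spectrum
      rw [← AlgEquiv.spectrum_eq (LinearMap.toMatrixOrthonormal b).toAlgEquiv] at h1
      rw [← toMatrix_actionLaplacian]
      exact spectrum.of_algebraMap_mem ℂ h1
    have := hgap _ (matrixRep b U)
    exact Set.eq_empty_iff_forall_notMem.1 this (μ i)
      ⟨hmem, lt_of_le_of_ne h0 (Ne.symm hcon.1), hcon.2⟩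
  classical
  -- The orthogonal projection of `x` onto the kernel. On its complement every eigenvalue is at
  -- least `lam`, so `lam * ‖x - y‖ ≤ ‖T x‖ ≤ δ`.
  let y := ∑ i, if μ i = 0 then b.repr x i • b i else 0
  have hTy : T y = 0 := by
    simp only [y, map_sum]
    refine Finset.sum_eq_zero fun i _ => ?_
    split_ifs with h
    · rw [map_smul, hTb, h]; simp
    · simp
  refine ⟨y, hker y hTy, ?_⟩
  have hTx : ‖T x‖ ≤ δ := by
    rw [hT, actionLaplacian_apply hne, norm_smul]
    have : ‖∑ s ∈ S, (x - U s x)‖ ≤ ∑ s ∈ S, δ :=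
      (norm_sum_le _ _).trans (Finset.sum_le_sum fun s hs => by
        rw [norm_sub_rev]; exact hx s hs)
    rw [Finset.sum_const, nsmul_eq_mul] at this
    rw [norm_inv, Complex.norm_natCast, inv_mul_le_iff₀ hcard]
    exact this
  have hexp : x - y = ∑ i, if μ i = 0 then 0 else b.repr x i • b i := by
    conv_lhs => rw [← b.sum_repr x]
    rw [← Finset.sum_sub_distrib]
    refine Finset.sum_congr rfl fun i _ => ?_
    split_ifs <;> simp
  have hr : ∀ i, b.repr (x - y) i = if μ i = 0 then 0 else b.repr x i := by
    intro i
    rw [hexp, b.repr_apply_apply, inner_sum, Finset.sum_eq_single i]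
    · split_ifs
      · simp
      · rw [inner_smul_right, inner_self_eq_norm_sq_to_K, b.norm_eq_one]; simp
    · intro j _ hj
      split_ifs
      · simp
      · rw [inner_smul_right, b.inner_eq_zero hj.symm, mul_zero]
    · simp
  have hrT : ∀ i, b.repr (T x) i = μ i * b.repr x i := fun i =>
    hsym.eigenvectorBasis_apply_self_apply rfl x i
  have hle : (lam * ‖x - y‖) ^ 2 ≤ ‖T x‖ ^ 2 := by
    rw [mul_pow, ← b.repr.norm_map (x - y), ← b.repr.norm_map (T x), EuclideanSpace.norm_sq_eq,
      EuclideanSpace.norm_sq_eq, Finset.mul_sum]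
    refine Finset.sum_le_sum fun i _ => ?_
    rw [hr, hrT, norm_mul, mul_pow]
    rcases hμ i with h | h
    · simp [h]
    · rw [if_neg (by linarith), Complex.norm_real, Real.norm_of_nonneg (by linarith)]
      gcongr
  have := abs_le_of_sq_le_sq' hle (norm_nonneg _)
  rw [le_div_iff₀ hlam]
  linarith

end SpectralGap

/-! ### Perturbing a rank-one quadratic form. -/

section TopEigenvector

variable {E : Type*} [NormedAddCommGroup E] [InnerProductSpace ℂ E]

theorem norm_sq_sub_inner_smul {ξ : E} (hξ : ‖ξ‖ = 1) (w : E) :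
    ‖w - (inner ℂ ξ w : ℂ) • ξ‖ ^ 2 = ‖w‖ ^ 2 - ‖(inner ℂ ξ w : ℂ)‖ ^ 2 := by
  rw [@norm_sub_sq ℂ, inner_smul_right, norm_smul, hξ, mul_one]
  have h : inner ℂ ξ w * inner ℂ w ξ = ((‖(inner ℂ ξ w : ℂ)‖ ^ 2 : ℝ) : ℂ) := by
    rw [← inner_conj_symm w ξ, Complex.mul_conj, Complex.normSq_eq_norm_sq]
  rw [h]
  simp only [RCLike.re_to_complex, Complex.ofReal_re]
  ring

theorem inner_sub_inner_smul {ξ : E} (hξ : ‖ξ‖ = 1) (w : E) :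
    inner ℂ ξ (w - (inner ℂ ξ w : ℂ) • ξ) = 0 := by
  rw [inner_sub_right, inner_smul_right, inner_self_eq_norm_sq_to_K, hξ]
  simp

/-- If the quadratic form of `T` is close to that of the projection onto a unit vector `e`, then
the top eigenvector of the real part of `T` is close to `e`, and unit vectors that almost attain
the maximum of the form are almost multiples of it. -/
theorem exists_almost_maximizers_unique [FiniteDimensional ℂ E] (T : E →ₗ[ℂ] E) {e : E}
    (he : ‖e‖ = 1)
    (h : ∀ v, |(inner ℂ (T v) v).re - ‖(inner ℂ e v : ℂ)‖ ^ 2| ≤ ‖v‖ ^ 2 / 8) :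
    ∃ ξ : E, ‖ξ‖ = 1 ∧ 3 / 4 ≤ ‖(inner ℂ e ξ : ℂ)‖ ^ 2 ∧
      ∀ w, ‖w‖ = 1 → ‖w - (inner ℂ ξ w : ℂ) • ξ‖ ^ 2
        ≤ 2 * ((inner ℂ (T ξ) ξ).re - (inner ℂ (T w) w).re) := by
  have : ProperSpace E := FiniteDimensional.proper ℂ E
  have : CompleteSpace E := FiniteDimensional.complete ℂ E
  let T' : E →L[ℂ] E := LinearMap.toContinuousLinearMap T
  -- `T` need not be self-adjoint, but only the real part of its form matters. Twice that part is
  -- the form of `A`, so its maximisers on the sphere are eigenvectors.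
  let A : E →L[ℂ] E := T' + ContinuousLinearMap.adjoint T'
  have hA : IsSelfAdjoint A := by
    rw [IsSelfAdjoint, ContinuousLinearMap.star_eq_adjoint, map_add,
      ContinuousLinearMap.adjoint_adjoint, add_comm]
  have hAT : ∀ v, (inner ℂ (A v) v).re = 2 * (inner ℂ (T v) v).re := fun v => by
    have h1 : (inner ℂ (ContinuousLinearMap.adjoint T' v) v).re = (inner ℂ (T v) v).re := by
      rw [ContinuousLinearMap.adjoint_inner_left, ← inner_conj_symm, Complex.conj_re]
      rfl
    rw [_root_.add_apply, inner_add_left, Complex.add_re, h1]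
    change (inner ℂ (T v) v).re + _ = _
    ring
  obtain ⟨ξ, hξ, hmax⟩ := (isCompact_sphere (0 : E) 1).exists_isMaxOn ⟨e, by simp [he]⟩
    A.reApplyInnerSelf_continuous.continuousOn
  have hξ1 : ‖ξ‖ = 1 := by simpa using hξ
  have hξ0 : ξ ≠ 0 := by rintro rfl; simp at hξ1
  obtain ⟨l, hl⟩ : ∃ l : ℝ, A ξ = (l : ℂ) • ξ :=
    ⟨_, (hA.hasEigenvector_of_isMaxOn hξ0 (by rwa [hξ1])).apply_eq_smul⟩
  have hQ : ∀ w, ‖w‖ = 1 → (inner ℂ (T w) w).re ≤ (inner ℂ (T ξ) ξ).re := fun w hw => by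
    have h1 : (inner ℂ (A w) w).re ≤ (inner ℂ (A ξ) ξ).re := hmax (by simpa using hw)
    rw [hAT, hAT] at h1
    linarith
  have hee : ‖(inner ℂ e e : ℂ)‖ = 1 := by
    rw [inner_self_eq_norm_sq_to_K, he]; simp
  have hQξ : 7 / 8 ≤ (inner ℂ (T ξ) ξ).re := by
    have h1 := (abs_le.1 (h e)).1
    rw [hee, he] at h1
    have := hQ e he
    linarith
  have heξ : 3 / 4 ≤ ‖(inner ℂ e ξ : ℂ)‖ ^ 2 := by
    have h1 := (abs_le.1 (h ξ)).2
    rw [hξ1] at h1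
    linarith
  refine ⟨ξ, hξ1, heξ, fun w hw => ?_⟩
  set β : ℂ := inner ℂ ξ w with hβ
  set v := w - β • ξ with hv
  have hξv : inner ℂ ξ v = 0 := inner_sub_inner_smul hξ1 w
  have hvξ : inner ℂ v ξ = 0 := by rw [← inner_conj_symm, hξv, map_zero]
  have hv2 : ‖v‖ ^ 2 = 1 - ‖β‖ ^ 2 := by
    rw [hv, norm_sq_sub_inner_smul hξ1, hw, one_pow, hβ]
  -- As `v ⟂ ξ`, only the component of `e` orthogonal to `ξ` counts, of squared norm at most `1 -
  -- 3/4`. The form is then at most `(1/4 + 1/8) ‖v‖²` on `v` against at least `7/8` at `ξ`: a gap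
  -- of `1/2`, whence the factor `2` in the conclusion.
  have hev : ‖(inner ℂ e v : ℂ)‖ ^ 2 ≤ 1 / 4 * ‖v‖ ^ 2 := by
    have h1 : inner ℂ e v = inner ℂ (e - (inner ℂ ξ e : ℂ) • ξ) v := by
      rw [inner_sub_left, inner_smul_left, hξv, mul_zero, sub_zero]
    have h2 := norm_sq_sub_inner_smul hξ1 e
    rw [he, norm_inner_symm] at h2
    rw [h1]
    calc _ ≤ (‖e - (inner ℂ ξ e : ℂ) • ξ‖ * ‖v‖) ^ 2 := by
          gcongr; exact norm_inner_le_norm _ _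
      _ ≤ _ := by rw [mul_pow]; gcongr; linarith
  have hQv : (inner ℂ (T v) v).re ≤ 3 / 8 * ‖v‖ ^ 2 := by
    have h1 := (abs_le.1 (h v)).2
    linarith
  have hw' : w = β • ξ + v := by rw [hv]; abel
  have hAw : (inner ℂ (A w) w).re = ‖β‖ ^ 2 * (inner ℂ (A ξ) ξ).re + (inner ℂ (A v) v).re := by
    have h1 : inner ℂ (A v) ξ = 0 := by
      rw [← ContinuousLinearMap.adjoint_inner_right, ← ContinuousLinearMap.star_eq_adjoint,
        hA.star_eq, hl, inner_smul_right, hvξ, mul_zero]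
    have h2 : inner ℂ (A ξ) v = 0 := by rw [hl, inner_smul_left, hξv, mul_zero]
    have h3 : conj β * β = ((‖β‖ ^ 2 : ℝ) : ℂ) := by
      rw [mul_comm, Complex.mul_conj, Complex.normSq_eq_norm_sq]
    rw [hw', map_add, map_smul, inner_add_left, inner_add_right, inner_add_right,
      inner_smul_left, inner_smul_left, inner_smul_right, inner_smul_right, h1, h2]
    simp only [mul_zero, add_zero, zero_add]
    rw [← mul_assoc, h3, Complex.add_re, Complex.re_ofReal_mul]
  rw [hAT, hAT, hAT] at hAw
  have hb : ‖β‖ ^ 2 = 1 - ‖v‖ ^ 2 := by linarith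
  rw [hb] at hAw
  nlinarith [sq_nonneg ‖v‖]

end TopEigenvector

/-! ### A closed convex set standing in for the operator-norm unit ball. -/

section Contractions

variable {m n : Type*} [Fintype m] [Fintype n]

/-- Matrices that do not increase the Frobenius norm under left and right multiplication. -/
def contractions (m n : Type*) [Fintype m] [Fintype n] : Set (Matrix m n ℂ) :=
  {z | (∀ a : Matrix m m ℂ, ‖a * z‖ ≤ ‖a‖) ∧ ∀ b : Matrix n n ℂ, ‖z * b‖ ≤ ‖b‖}

theorem isClosed_contractions : IsClosed (contractions m n) := by
  simp only [contractions, Set.ofPred_and, Set.ofPred_forall]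
  refine (isClosed_iInter fun a => isClosed_le ?_ continuous_const).inter
    (isClosed_iInter fun b => isClosed_le ?_ continuous_const)
  · exact continuous_norm.comp (by fun_prop)
  · exact continuous_norm.comp (by fun_prop)

theorem midpoint_mem_contractions {z w : Matrix m n ℂ} (hz : z ∈ contractions m n)
    (hw : w ∈ contractions m n) : (1 / 2 : ℂ) • (z + w) ∈ contractions m n := by
  have h : ‖(1 / 2 : ℂ)‖ = 1 / 2 := by simp
  refine ⟨fun a => ?_, fun b => ?_⟩
  · rw [Matrix.mul_smul, norm_smul, h, Matrix.mul_add]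
    have := norm_add_le (a * z) (a * w)
    linarith [hz.1 a, hw.1 a]
  · rw [Matrix.smul_mul, norm_smul, h, Matrix.add_mul]
    have := norm_add_le (z * b) (w * b)
    linarith [hz.2 b, hw.2 b]

variable {k : Type*}

theorem isometry_projection_mem_contractions [Fintype k] [DecidableEq k] {Q : Matrix k k ℂ} (hQ : IsStarProjection Q)
    {V : Matrix m k ℂ} (hV : Vᴴ * V = 1) {W : Matrix n k ℂ} (hW : Wᴴ * W = 1) :
    V * Q * Wᴴ ∈ contractions m n := by
  refine ⟨fun a => ?_, fun b => ?_⟩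
  · rw [← Matrix.mul_assoc, norm_mul_coisometry (by simpa using hW), ← Matrix.mul_assoc]
    exact (norm_mul_projection_le hQ _).trans (norm_mul_isometry_le hV _)
  · rw [Matrix.mul_assoc, Matrix.mul_assoc, norm_isometry_mul hV]
    exact (norm_projection_mul_le hQ _).trans (norm_coisometry_mul_le hW _)

end Contractions

/-! ### Invariance of the norm under unitaries. -/

section Unitary

variable {m n : Type*} [Fintype m] [Fintype n] [DecidableEq m]

theorem unitary_conjTranspose_mul (u : Matrix.unitaryGroup m ℂ) :
    (u : Matrix m m ℂ)ᴴ * (u : Matrix m m ℂ) = 1 := Matrix.mem_unitaryGroup_iff'.1 u.2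

theorem unitary_mul_conjTranspose (u : Matrix.unitaryGroup m ℂ) :
    (u : Matrix m m ℂ) * (u : Matrix m m ℂ)ᴴ = 1 := Matrix.mem_unitaryGroup_iff.1 u.2

theorem norm_unitary_mul (u : Matrix.unitaryGroup m ℂ) (x : Matrix m n ℂ) :
    ‖(u : Matrix m m ℂ) * x‖ = ‖x‖ := norm_isometry_mul (unitary_conjTranspose_mul u) x

theorem norm_unitary_conjTranspose_mul (u : Matrix.unitaryGroup m ℂ) (x : Matrix m n ℂ) :
    ‖(u : Matrix m m ℂ)ᴴ * x‖ = ‖x‖ :=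
  norm_isometry_mul (by simpa using unitary_mul_conjTranspose u) x

theorem norm_mul_unitary (u : Matrix.unitaryGroup m ℂ) (x : Matrix n m ℂ) :
    ‖x * (u : Matrix m m ℂ)‖ = ‖x‖ := norm_mul_coisometry (unitary_mul_conjTranspose u) x

theorem norm_mul_unitary_conjTranspose (u : Matrix.unitaryGroup m ℂ) (x : Matrix n m ℂ) :
    ‖x * (u : Matrix m m ℂ)ᴴ‖ = ‖x‖ :=
  norm_mul_coisometry (by simpa using unitary_conjTranspose_mul u) x

end Unitary

/-! ### Almost intertwiners obtained from fixed vectors. -/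

section Intertwiners

variable {Γ : Type*} [Group Γ] {m n k : Type*} [Fintype m] [Fintype n] [Fintype k]
  [DecidableEq m] [DecidableEq n] [DecidableEq k]

/-- The isometric action `x ↦ u x vᴴ` on rectangular matrices. -/
noncomputable def bimoduleIsometry (u : Matrix.unitaryGroup m ℂ) (v : Matrix.unitaryGroup n ℂ) :
    Matrix m n ℂ ≃ₗᵢ[ℂ] Matrix m n ℂ where
  toFun x := (u : Matrix m m ℂ) * x * (v : Matrix n n ℂ)ᴴ
  invFun x := (u : Matrix m m ℂ)ᴴ * x * (v : Matrix n n ℂ)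
  map_add' x y := by simp [Matrix.mul_add, Matrix.add_mul]
  map_smul' r x := by simp
  left_inv x := by
    simp only [Matrix.mul_assoc, unitary_conjTranspose_mul, Matrix.mul_one]
    rw [← Matrix.mul_assoc, unitary_conjTranspose_mul, Matrix.one_mul]
  right_inv x := by
    simp only [Matrix.mul_assoc, unitary_mul_conjTranspose, Matrix.mul_one]
    rw [← Matrix.mul_assoc, unitary_mul_conjTranspose, Matrix.one_mul]
  norm_map' x := by
    change ‖(u : Matrix m m ℂ) * x * (v : Matrix n n ℂ)ᴴ‖ = ‖x‖
    rw [norm_mul_unitary_conjTranspose, norm_unitary_mul]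

theorem bimoduleIsometry_apply (u : Matrix.unitaryGroup m ℂ) (v : Matrix.unitaryGroup n ℂ)
    (x : Matrix m n ℂ) :
    bimoduleIsometry u v x = (u : Matrix m m ℂ) * x * (v : Matrix n n ℂ)ᴴ := rfl

/-- The unitary action `x ↦ α(g) x β(g)ᴴ` on rectangular matrices. -/
noncomputable def bimoduleAction (α : Γ →* Matrix.unitaryGroup m ℂ)
    (β : Γ →* Matrix.unitaryGroup n ℂ) : Γ →* (Matrix m n ℂ ≃ₗᵢ[ℂ] Matrix m n ℂ) where
  toFun g := bimoduleIsometry (α g) (β g)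
  map_one' := by
    ext1 x
    simp [bimoduleIsometry_apply]
  map_mul' g h := by
    ext1 x
    simp [bimoduleIsometry_apply, Matrix.mul_assoc]

theorem bimoduleAction_apply (α : Γ →* Matrix.unitaryGroup m ℂ)
    (β : Γ →* Matrix.unitaryGroup n ℂ) (g : Γ) (x : Matrix m n ℂ) :
    bimoduleAction α β g x = (α g : Matrix m m ℂ) * x * (β g : Matrix n n ℂ)ᴴ := rfl

theorem norm_bimoduleAction_sub (α : Γ →* Matrix.unitaryGroup m ℂ)
    (β : Γ →* Matrix.unitaryGroup n ℂ) (g : Γ) (x : Matrix m n ℂ) :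
    ‖bimoduleAction α β g x - x‖
      = ‖(α g : Matrix m m ℂ) * x - x * (β g : Matrix n n ℂ)‖ := by
  rw [bimoduleAction_apply, ← norm_mul_unitary (β g), Matrix.sub_mul, Matrix.mul_assoc _ _ᴴ,
    unitary_conjTranspose_mul, Matrix.mul_one]

theorem bimoduleAction_mem_contractions (α : Γ →* Matrix.unitaryGroup m ℂ)
    (β : Γ →* Matrix.unitaryGroup n ℂ) (g : Γ) {z : Matrix m n ℂ} (hz : z ∈ contractions m n) :
    bimoduleAction α β g z ∈ contractions m n := by
  rw [bimoduleAction_apply]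
  refine ⟨fun a => ?_, fun b => ?_⟩
  · rw [← Matrix.mul_assoc, norm_mul_unitary_conjTranspose, ← Matrix.mul_assoc]
    exact (hz.1 _).trans (norm_mul_unitary _ _).le
  · rw [Matrix.mul_assoc, Matrix.mul_assoc, norm_unitary_mul]
    exact (hz.2 _).trans (norm_unitary_conjTranspose_mul _ _).le

variable {α' : Γ →* Matrix.unitaryGroup m ℂ} {β' : Γ →* Matrix.unitaryGroup n ℂ}
  {V : Matrix m k ℂ} {W : Matrix n k ℂ} {α β : Γ → Matrix k k ℂ}

/-- Replace `α' g` by `V (α g) Vᴴ` and `β' g` by `W (β g) Wᴴ`. The two errors multiply `V Q Wᴴ`,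
which is a contraction, so they enter without loss. -/
theorem norm_bimoduleAction_compression_sub_le (hV : Vᴴ * V = 1) (hW : Wᴴ * W = 1)
    {Q : Matrix k k ℂ} (hQ : IsStarProjection Q) (g : Γ) :
    ‖bimoduleAction α' β' g (V * Q * Wᴴ) - V * Q * Wᴴ‖ ≤ ‖α g * Q - Q * β g‖
      + (‖V * α g * Vᴴ - (α' g : Matrix m m ℂ)‖ + ‖W * β g * Wᴴ - (β' g : Matrix n n ℂ)‖) := by
  have hx := isometry_projection_mem_contractions hQ hV hW
  rw [norm_bimoduleAction_sub]
  have h1 : V * α g * Vᴴ * (V * Q * Wᴴ) = V * (α g * Q) * Wᴴ := by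
    calc _ = V * (α g * (Vᴴ * V) * Q) * Wᴴ := by simp only [Matrix.mul_assoc]
      _ = _ := by rw [hV, Matrix.mul_one]
  have h2 : V * Q * Wᴴ * (W * β g * Wᴴ) = V * (Q * β g) * Wᴴ := by
    calc _ = V * (Q * (Wᴴ * W) * β g) * Wᴴ := by simp only [Matrix.mul_assoc]
      _ = _ := by rw [hW, Matrix.mul_one]
  have h3 : (α' g : Matrix m m ℂ) * (V * Q * Wᴴ) - V * Q * Wᴴ * (β' g : Matrix n n ℂ)
      = V * (α g * Q - Q * β g) * Wᴴ - (V * α g * Vᴴ - (α' g : Matrix m m ℂ)) * (V * Q * Wᴴ)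
        + V * Q * Wᴴ * (W * β g * Wᴴ - (β' g : Matrix n n ℂ)) := by
    rw [Matrix.sub_mul, Matrix.mul_sub, Matrix.mul_sub, Matrix.sub_mul, h1, h2]
    abel
  rw [h3]
  refine (norm_add_le _ _).trans ?_
  have h4 := norm_sub_le (V * (α g * Q - Q * β g) * Wᴴ)
    ((V * α g * Vᴴ - (α' g : Matrix m m ℂ)) * (V * Q * Wᴴ))
  have h5 : ‖V * (α g * Q - Q * β g) * Wᴴ‖ = ‖α g * Q - Q * β g‖ := by
    rw [norm_mul_coisometry (by simpa using hW), norm_isometry_mul hV]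
  have h6 := hx.1 (V * α g * Vᴴ - (α' g : Matrix m m ℂ))
  have h7 := hx.2 (W * β g * Wᴴ - (β' g : Matrix n n ℂ))
  linarith

/-- If `α` and `β` are close to compressions of representations `α'` and `β'`, and the projection
`Q` is almost fixed by `α'` and `β'` on the set `S` exhibiting the spectral gap, then near `Q`
there is an almost intertwiner from `β` to `α`. -/
theorem exists_almost_intertwiner {S : Finset Γ} (hS : ∀ s ∈ S, s⁻¹ ∈ S)
    (hgen : Subgroup.closure (S : Set Γ) = ⊤) {lam : ℝ} (hlam : 0 < lam)
    (hgap : ∀ (d : ℕ) (π : Γ →* Matrix.unitaryGroup (Fin d) ℂ),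
        spectrum ℝ (laplacian S π) ∩ Set.Ioo 0 lam = ∅)
    (hV : Vᴴ * V = 1) (hW : Wᴴ * W = 1)
    {Q : Matrix k k ℂ} (hQ : IsStarProjection Q) {δ : ℝ} (hδ : 0 ≤ δ)
    (hx : ∀ s ∈ S, ‖bimoduleAction α' β' s (V * Q * Wᴴ) - V * Q * Wᴴ‖ ≤ δ) :
    ∃ y : Matrix k k ℂ, ‖y - Q‖ ≤ 2 * (δ / lam) ∧ ∀ g, ‖α g * y - y * β g‖ ≤
      ‖V * α g * Vᴴ - (α' g : Matrix m m ℂ)‖ + ‖W * β g * Wᴴ - (β' g : Matrix n n ℂ)‖ := by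
  set x := V * Q * Wᴴ with hxdef
  obtain ⟨x', hx', hd⟩ := exists_fixed_near hS hgen hlam hgap (bimoduleAction α' β') hδ hx
  -- The fixed vector `x'` has no operator-norm bound, while the errors `V α Vᴴ - α'` and `W β Wᴴ -
  -- β'` are controlled only in the Hilbert–Schmidt norm and will multiply it. Moving it into the
  -- contractions costs the factor `2`.
  obtain ⟨z, hz, hzfix, hzd⟩ := exists_fixed_mem_of_fixed (bimoduleAction α' β')
    isClosed_contractions (fun a ha b hb => midpoint_mem_contractions ha hb)
    (fun g a ha => bimoduleAction_mem_contractions α' β' g ha)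
    (isometry_projection_mem_contractions hQ hV hW) hx'
  refine ⟨Vᴴ * z * W, ?_, fun g => ?_⟩
  · have h1 : Vᴴ * z * W - Q = Vᴴ * (z - x) * W := by
      have : Vᴴ * x * W = Q := by
        calc _ = (Vᴴ * V) * Q * (Wᴴ * W) := by simp only [hxdef, Matrix.mul_assoc]
          _ = Q := by rw [hV, hW, Matrix.one_mul, Matrix.mul_one]
      rw [Matrix.mul_sub, Matrix.sub_mul, this]
    rw [h1]
    calc _ ≤ ‖z - x‖ := (norm_mul_isometry_le hW _).trans (norm_coisometry_mul_le hV _)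
      _ ≤ 2 * ‖x - x'‖ := by rw [norm_sub_rev]; exact hzd
      _ ≤ _ := by gcongr
  · have hint : (α' g : Matrix m m ℂ) * z = z * (β' g : Matrix n n ℂ) := by
      have h := norm_bimoduleAction_sub α' β' g z
      rw [hzfix, sub_self, norm_zero] at h
      exact sub_eq_zero.1 (norm_eq_zero.1 h.symm)
    have h1 : α g * (Vᴴ * z * W) - Vᴴ * z * W * β g
        = Vᴴ * ((V * α g * Vᴴ - (α' g : Matrix m m ℂ)) * z) * W
          - Vᴴ * (z * (W * β g * Wᴴ - (β' g : Matrix n n ℂ))) * W := by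
      have h2 : Vᴴ * (V * α g * Vᴴ * z) * W = α g * (Vᴴ * z * W) := by
        calc _ = (Vᴴ * V) * (α g * (Vᴴ * z * W)) := by simp only [Matrix.mul_assoc]
          _ = _ := by rw [hV, Matrix.one_mul]
      have h3 : Vᴴ * (z * (W * β g * Wᴴ)) * W = Vᴴ * z * W * β g := by
        calc _ = (Vᴴ * z * W * β g) * (Wᴴ * W) := by simp only [Matrix.mul_assoc]
          _ = _ := by rw [hW, Matrix.mul_one]
      rw [Matrix.sub_mul, Matrix.mul_sub z, hint, Matrix.mul_sub, Matrix.mul_sub, Matrix.sub_mul,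
        Matrix.sub_mul, h2, h3]
      abel
    rw [h1]
    refine (norm_sub_le _ _).trans (add_le_add ?_ ?_)
    · exact ((norm_mul_isometry_le hW _).trans (norm_coisometry_mul_le hV _)).trans (hz.1 _)
    · exact ((norm_mul_isometry_le hW _).trans (norm_coisometry_mul_le hV _)).trans (hz.2 _)

end Intertwiners

/-! ### From an almost intertwiner on the tensor square to an almost invariant line. -/

section Realignment

variable {n : Type*} [Fintype n]

/-- The operator on matrices whose sesquilinear form is `(x, y) ↦ ⟪x ⊗ ȳ, z⟫`. -/
noncomputable def realign (z : Matrix (n × n) (n × n) ℂ) : Matrix n n ℂ →ₗ[ℂ] Matrix n n ℂ where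
  toFun x := Matrix.of fun i k => ∑ j, ∑ l, z (i, j) (k, l) * x j l
  map_add' x y := by
    ext i k
    simp [mul_add, Finset.sum_add_distrib]
  map_smul' r x := by
    ext i k
    simp only [of_apply, Matrix.smul_apply, smul_eq_mul, Finset.mul_sum, RingHom.id_apply]
    exact Finset.sum_congr rfl fun _ _ => Finset.sum_congr rfl fun _ _ => by ring

theorem inner_eq_sum {m : Type*} [Fintype m] (x y : Matrix m n ℂ) :
    inner ℂ x y = ∑ i, ∑ k, conj (x i k) * y i k := by
  rw [inner_eq_trace, Finset.sum_comm]
  simp [trace, mul_apply]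

theorem inner_realign (z : Matrix (n × n) (n × n) ℂ) (x y : Matrix n n ℂ) :
    inner ℂ x (realign z y) = inner ℂ (conjKronecker x y) z := by
  rw [inner_eq_sum, inner_eq_sum]
  simp only [Fintype.sum_prod_type, realign, LinearMap.coe_mk, AddHom.coe_mk, of_apply,
    conjKronecker, kroneckerMap_apply, map_apply, Finset.mul_sum, map_mul, Complex.conj_conj]
  refine Finset.sum_congr rfl fun i _ => ?_
  rw [Finset.sum_comm]
  exact Finset.sum_congr rfl fun j _ => Finset.sum_congr rfl fun k _ =>
    Finset.sum_congr rfl fun l _ => by ring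

theorem re_inner_realign (z : Matrix (n × n) (n × n) ℂ) (x : Matrix n n ℂ) :
    (inner ℂ (realign z x) x).re = (inner ℂ (conjKronecker x x) z).re := by
  rw [← inner_realign, ← inner_conj_symm, Complex.conj_re]

variable [DecidableEq n]

/-- An almost intertwiner near the projection `q ⊗ q̄`, from `r ⊗ r̄` to `p ⊗ p̄`, gives a unit
matrix `ξ` whose line is almost invariant under `x ↦ p(g) x r(g)ᴴ`. -/
theorem exists_almost_invariant_line {Γ : Type*} {q : Matrix n n ℂ} (hq0 : q ≠ 0)
    (p r : Γ → Matrix.unitaryGroup n ℂ) {z : Matrix (n × n) (n × n) ℂ}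
    (hz : ‖z - conjKronecker q q‖ ≤ ‖q‖ ^ 2 / 8) {η : Γ → ℝ}
    (hη : ∀ g, ‖conjKronecker (p g : Matrix n n ℂ) (p g) * z
      - z * conjKronecker (r g : Matrix n n ℂ) (r g)‖ ≤ η g) :
    ∃ ξ : Matrix n n ℂ, ‖ξ‖ = 1 ∧ 3 / 4 * ‖q‖ ^ 2 ≤ ‖(inner ℂ q ξ : ℂ)‖ ^ 2 ∧
      ∀ g, ∃ b : ℂ, ‖(p g : Matrix n n ℂ) * ξ * (r g : Matrix n n ℂ)ᴴ - b • ξ‖ ^ 2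
        ≤ 2 * (η g / ‖q‖ ^ 2) := by
  have hq : 0 < ‖q‖ := norm_pos_iff.2 hq0
  set e : Matrix n n ℂ := ((‖q‖⁻¹ : ℝ) : ℂ) • q with he
  set T := ((‖q‖ ^ 2)⁻¹ : ℂ) • realign z with hT
  have hTre : ∀ v, (inner ℂ (T v) v).re
      = (‖q‖ ^ 2)⁻¹ * (inner ℂ (conjKronecker v v) z).re := fun v => by
    rw [hT, LinearMap.smul_apply, inner_smul_left, ← re_inner_realign]
    rw [← Complex.ofReal_pow, ← Complex.ofReal_inv, Complex.conj_ofReal, Complex.re_ofReal_mul]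
  have he1 : ‖e‖ = 1 := by
    rw [he, norm_smul, Complex.norm_real, Real.norm_of_nonneg (by positivity),
      inv_mul_cancel₀ hq.ne']
  have hinner : ∀ v, ‖(inner ℂ e v : ℂ)‖ ^ 2 = (‖q‖ ^ 2)⁻¹ * ‖(inner ℂ q v : ℂ)‖ ^ 2 := fun v => by
    rw [he, inner_smul_left, norm_mul, Complex.conj_ofReal, Complex.norm_real,
      Real.norm_of_nonneg (by positivity), mul_pow, inv_pow]
  obtain ⟨ξ, hξ1, hξe, hξ⟩ := exists_almost_maximizers_unique T he1 fun v => by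
    -- The form realigned from `q ⊗ q̄` is exactly the rank-one form of `q`, so `T` differs from the
    -- projection onto `e` by at most `1/8`.
    have h1 : ‖(inner ℂ q v : ℂ)‖ ^ 2
        = (inner ℂ (conjKronecker v v) (conjKronecker q q)).re := by
      rw [inner_conjKronecker, Complex.mul_conj, Complex.ofReal_re, Complex.normSq_eq_norm_sq,
        norm_inner_symm]
    rw [hTre, hinner, h1, ← mul_sub, ← Complex.sub_re, ← inner_sub_right, abs_mul,
      abs_of_nonneg (by positivity), inv_mul_le_iff₀ (by positivity)]
    calc _ ≤ ‖conjKronecker v v‖ * ‖z - conjKronecker q q‖ :=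
          (Complex.abs_re_le_norm _).trans (norm_inner_le_norm _ _)
      _ ≤ ‖v‖ * ‖v‖ * (‖q‖ ^ 2 / 8) := by rw [norm_conjKronecker]; gcongr
      _ = _ := by ring
  refine ⟨ξ, hξ1, ?_, fun g => ⟨inner ℂ ξ ((p g : Matrix n n ℂ) * ξ * (r g : Matrix n n ℂ)ᴴ), ?_⟩⟩
  · rw [hinner, le_inv_mul_iff₀ (by positivity)] at hξe
    linarith
  · refine (hξ _ ?_).trans ?_
    · rw [norm_mul_unitary_conjTranspose, norm_unitary_mul, hξ1]
    · set P := conjKronecker (p g : Matrix n n ℂ) (p g)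
      set R := conjKronecker (r g : Matrix n n ℂ) (r g)
      have hP : Pᴴ * P = 1 := by
        rw [conjTranspose_conjKronecker, ← conjKronecker_mul, unitary_conjTranspose_mul,
          conjKronecker_one]
      have h1 : conjKronecker ((p g : Matrix n n ℂ) * ξ * (r g : Matrix n n ℂ)ᴴ)
          ((p g : Matrix n n ℂ) * ξ * (r g : Matrix n n ℂ)ᴴ) = P * conjKronecker ξ ξ * Rᴴ := by
        rw [conjKronecker_mul, conjKronecker_mul, conjTranspose_conjKronecker]
      -- The form at `p ξ rᴴ` pairs `ξ ⊗ ξ̄` with `Pᴴ z R`, so its drop from the maximum is at most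
      -- the intertwining error of `z`.
      have h2 : z - Pᴴ * (z * R) = Pᴴ * (P * z - z * R) := by
        rw [Matrix.mul_sub, ← Matrix.mul_assoc Pᴴ P, hP, Matrix.one_mul]
      gcongr 2 * ?_
      rw [hTre, hTre, ← mul_sub, inv_mul_eq_div, h1]
      gcongr
      rw [inner_mul_right_eq, inner_mul_left_eq, conjTranspose_conjTranspose, ← Complex.sub_re,
        ← inner_sub_right, h2]
      calc _ ≤ ‖conjKronecker ξ ξ‖ * ‖Pᴴ * (P * z - z * R)‖ :=
            (Complex.re_le_norm _).trans (norm_inner_le_norm _ _)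
        _ ≤ ‖conjKronecker ξ ξ‖ * ‖P * z - z * R‖ := by
            gcongr; exact norm_coisometry_mul_le hP _
        _ ≤ η g := by rw [norm_conjKronecker, hξ1, one_mul, one_mul]; exact hη g

end Realignment

/-- The `b n g` are eventually bounded, so they converge along one ultrafilter for all `g` at once,
with no countability needed. The limits have modulus one and satisfy the coboundary relation
exactly. -/
theorem isTwoCoboundary_of_tendsto {Γ : Type*} [Group Γ] {c : Γ → Γ → Circle}
    (b : ℕ → Γ → ℂ) (hb : ∀ g, Tendsto (fun n => ‖b n g‖) atTop (𝓝 1))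
    (hmul : ∀ g h, Tendsto (fun n => b n g * b n h - c g h * b n (g * h)) atTop (𝓝 0)) :
    IsTwoCoboundary c := by
  have hU : (hyperfilter ℕ : Filter ℕ) ≤ atTop := Nat.hyperfilter_le_atTop
  have hlim : ∀ g, ∃ z : ℂ, Tendsto (fun n => b n g) (hyperfilter ℕ) (𝓝 z) := fun g => by
    have hmem : ((hyperfilter ℕ).map fun n => b n g : Filter ℂ) ≤ 𝓟 (Metric.closedBall 0 2) := by
      rw [le_principal_iff]
      refine hU (((hb g).eventually_le_const (by norm_num : (1 : ℝ) < 2)).mono fun n hn => ?_)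
      simpa using hn
    obtain ⟨z, -, hz⟩ := (isCompact_closedBall (0 : ℂ) 2).ultrafilter_le_nhds _ hmem
    exact ⟨z, hz⟩
  choose z hz using hlim
  have hz1 : ∀ g, ‖z g‖ = 1 := fun g => tendsto_nhds_unique (hz g).norm ((hb g).mono_left hU)
  obtain ⟨b', hb'⟩ : ∃ b' : Γ → Circle, ∀ g, (b' g : ℂ) = z g :=
    ⟨fun g => ⟨z g, mem_sphere_zero_iff_norm.2 (hz1 g)⟩, fun _ => rfl⟩
  refine ⟨b', fun g h => ?_⟩
  have h1 : z g * z h - c g h * z (g * h) = 0 := tendsto_nhds_unique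
    (((hz g).mul (hz h)).sub ((hz (g * h)).const_mul _)) ((hmul g h).mono_left hU)
  rw [eq_mul_inv_iff_mul_eq]
  exact Circle.ext (by simpa [hb'] using (sub_eq_zero.1 h1).symm)

/-! ### Multiplicativity of the scalars up to the cocycle. -/

section AlmostMultiplicative

variable {n : Type*} [Fintype n] [DecidableEq n]

/-- Applying `x ↦ p x rᴴ` twice compares `b₁ b₂ ξ` with `c b₃ ξ`, up to the failure of
multiplicativity of `p` and `r`. That failure is small only in normalised Hilbert–Schmidt norm, and
`ξ` has no operator-norm bound, so its product with `ξ` need not be small. Pairing with `q` moves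
the error off `ξ`, where Cauchy–Schwarz applies; it also restricts `p` to the corner on which it is
projective. -/
theorem norm_mul_sub_mul_inner_le {q ξ : Matrix n n ℂ} (hq : IsStarProjection q) (hξ : ‖ξ‖ = 1)
    (p₁ p₂ p₃ r₁ r₂ r₃ : Matrix.unitaryGroup n ℂ)
    (c : Circle) (b₁ b₂ b₃ : ℂ) :
    ‖b₁ * b₂ - c * b₃‖ * ‖(inner ℂ q ξ : ℂ)‖ ≤
      (‖(p₂ : Matrix n n ℂ) * ξ * (r₂ : Matrix n n ℂ)ᴴ - b₂ • ξ‖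
        + ‖b₂‖ * ‖(p₁ : Matrix n n ℂ) * ξ * (r₁ : Matrix n n ℂ)ᴴ - b₁ • ξ‖
        + ‖(p₃ : Matrix n n ℂ) * ξ * (r₃ : Matrix n n ℂ)ᴴ - b₃ • ξ‖) * ‖q‖
      + (‖q * ((p₁ : Matrix n n ℂ) * (p₂ : Matrix n n ℂ)) - (c : ℂ) • (q * (p₃ : Matrix n n ℂ))‖
        + ‖(r₃ : Matrix n n ℂ) - (r₁ : Matrix n n ℂ) * (r₂ : Matrix n n ℂ)‖) := by
  have hqs : qᴴ = q := hq.isSelfAdjoint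
  have hqi : q * q = q := hq.isIdempotentElem
  have hc : ‖(c : ℂ)‖ = 1 := Circle.norm_coe c
  set P₁ : Matrix n n ℂ := p₁.1
  set P₂ : Matrix n n ℂ := p₂.1
  set P₃ : Matrix n n ℂ := p₃.1
  set R₁ : Matrix n n ℂ := r₁.1
  set R₂ : Matrix n n ℂ := r₂.1
  set R₃ : Matrix n n ℂ := r₃.1
  have hdecomp : (b₁ * b₂ - c * b₃) • ξ
      = -(P₁ * (P₂ * ξ * R₂ᴴ - b₂ • ξ) * R₁ᴴ) - b₂ • (P₁ * ξ * R₁ᴴ - b₁ • ξ)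
        + (c : ℂ) • (P₃ * ξ * R₃ᴴ - b₃ • ξ)
        + (P₁ * P₂ * ξ * (R₁ * R₂)ᴴ - (c : ℂ) • (P₃ * ξ * R₃ᴴ)) := by
    have : P₁ * (P₂ * ξ * R₂ᴴ - b₂ • ξ) * R₁ᴴ
        = P₁ * P₂ * ξ * (R₁ * R₂)ᴴ - b₂ • (P₁ * ξ * R₁ᴴ) := by
      simp only [conjTranspose_mul, Matrix.mul_sub, Matrix.sub_mul, Matrix.mul_smul,
        Matrix.smul_mul, Matrix.mul_assoc]
    rw [this]
    module
  have hE : ‖-(P₁ * (P₂ * ξ * R₂ᴴ - b₂ • ξ) * R₁ᴴ) - b₂ • (P₁ * ξ * R₁ᴴ - b₁ • ξ)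
        + (c : ℂ) • (P₃ * ξ * R₃ᴴ - b₃ • ξ)‖
      ≤ ‖P₂ * ξ * R₂ᴴ - b₂ • ξ‖ + ‖b₂‖ * ‖P₁ * ξ * R₁ᴴ - b₁ • ξ‖
        + ‖P₃ * ξ * R₃ᴴ - b₃ • ξ‖ := by
    refine (norm_add_le _ _).trans (add_le_add ((norm_sub_le _ _).trans (add_le_add ?_ ?_)) ?_)
    · rw [norm_neg, norm_mul_unitary_conjTranspose, norm_unitary_mul]
    · rw [norm_smul]
    · rw [norm_smul, hc, one_mul]
  have hD : ‖(inner ℂ q (P₁ * P₂ * ξ * (R₁ * R₂)ᴴ - (c : ℂ) • (P₃ * ξ * R₃ᴴ)) : ℂ)‖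
      ≤ ‖q * (P₁ * P₂) - (c : ℂ) • (q * P₃)‖ + ‖R₃ - R₁ * R₂‖ := by
    have h1 : inner ℂ q (P₁ * P₂ * ξ * (R₁ * R₂)ᴴ - (c : ℂ) • (P₃ * ξ * R₃ᴴ))
        = inner ℂ ((q * (P₁ * P₂) - (c : ℂ) • (q * P₃))ᴴ * (q * (R₁ * R₂))) ξ
          - (c : ℂ) * inner ℂ (P₃ᴴ * (q * (R₃ - R₁ * R₂))) ξ := by
      have e1 : inner ℂ ((q * (P₁ * P₂) - (c : ℂ) • (q * P₃))ᴴ * (q * (R₁ * R₂))) ξ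
          = inner ℂ q ((P₁ * P₂ - (c : ℂ) • P₃) * ξ * (R₁ * R₂)ᴴ) := by
        rw [inner_mul_left_eq, inner_mul_right_eq, conjTranspose_conjTranspose,
          ← Matrix.mul_smul, ← Matrix.mul_sub, Matrix.mul_assoc q, Matrix.mul_assoc q]
        conv_lhs => rw [← hqs, ← inner_mul_left_eq, hqs, hqi]
      have e2 : inner ℂ (P₃ᴴ * (q * (R₃ - R₁ * R₂))) ξ
          = inner ℂ q (P₃ * ξ * (R₃ - R₁ * R₂)ᴴ) := by
        rw [inner_mul_left_eq, inner_mul_right_eq, conjTranspose_conjTranspose]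
      rw [e1, e2, ← inner_smul_right, ← inner_sub_right]
      congr 1
      simp only [conjTranspose_sub, Matrix.mul_sub, Matrix.sub_mul, Matrix.smul_mul, smul_sub]
      abel
    rw [h1]
    refine (norm_sub_le _ _).trans (add_le_add ?_ ?_)
    · refine (norm_inner_le_norm _ _).trans ?_
      rw [hξ, mul_one, ← Matrix.mul_assoc, ← Matrix.mul_assoc, norm_mul_unitary, norm_mul_unitary,
        ← frobenius_norm_conjTranspose (q * _ - _)]
      exact norm_mul_projection_le hq _
    · rw [norm_mul, hc, one_mul]
      refine (norm_inner_le_norm _ _).trans ?_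
      rw [hξ, mul_one, norm_unitary_conjTranspose_mul]
      exact norm_projection_mul_le hq _
  have hfinal : (b₁ * b₂ - c * b₃) * inner ℂ q ξ
      = inner ℂ q ((b₁ * b₂ - c * b₃) • ξ) := by rw [inner_smul_right]
  rw [← norm_mul, hfinal, hdecomp, inner_add_right]
  refine (norm_add_le _ _).trans (add_le_add ((norm_inner_le_norm _ _).trans ?_) hD)
  rw [mul_comm]
  gcongr

end AlmostMultiplicative

/-! ### Stability on the tensor square. -/

section Stability

theorem norm_unitary {n : Type*} [Fintype n] [DecidableEq n] (u : Matrix.unitaryGroup n ℂ) :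
    ‖(u : Matrix n n ℂ)‖ = Real.sqrt (Fintype.card n) := by
  rw [eq_comm, Real.sqrt_eq_iff_mul_self_eq (by positivity) (norm_nonneg _), ← sq,
    ← re_trace_conjTranspose_mul_self, unitary_conjTranspose_mul]
  simp

theorem norm_eq_hsNorm_mul {d : ℕ} (x : Matrix (Fin d) (Fin d) ℂ) :
    ‖x‖ = hsNorm x * Real.sqrt d := by
  rcases Nat.eq_zero_or_pos d with rfl | hd
  · rw [Subsingleton.elim x 0]; simp
  · rw [hsNorm_eq, div_mul_cancel₀ _ (by positivity)]

/-- Conjugation of a unitary by a unitary rectangular matrix. -/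
noncomputable def conjUnitary {m n : Type*} [Fintype m] [Fintype n] [DecidableEq m] [DecidableEq n]
    (w : Matrix m n ℂ) (h₁ : wᴴ * w = 1) (h₂ : w * wᴴ = 1) (u : Matrix.unitaryGroup n ℂ) :
    Matrix.unitaryGroup m ℂ :=
  ⟨w * (u : Matrix n n ℂ) * wᴴ, by
    rw [Matrix.mem_unitaryGroup_iff, star_eq_conjTranspose]
    calc _ = w * ((u : Matrix n n ℂ) * (wᴴ * w) * (u : Matrix n n ℂ)ᴴ) * wᴴ := by
          simp only [conjTranspose_mul, conjTranspose_conjTranspose, Matrix.mul_assoc]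
      _ = 1 := by
          rw [h₁, Matrix.mul_one, unitary_mul_conjTranspose, Matrix.mul_one, h₂]⟩

/-- Stability for asymptotic representations on `ℂᵈ ⊗ ℂᵈ`, stated with the unnormalized
Hilbert–Schmidt norm. -/
theorem IsHilbertSchmidtStable.exists_approx {Γ : Type*} [Group Γ]
    (hstab : IsHilbertSchmidtStable Γ)
    {d : ℕ → ℕ} (α : (n : ℕ) → Γ → Matrix.unitaryGroup (Fin (d n) × Fin (d n)) ℂ)
    (hα : ∀ g h, Tendsto (fun n => ‖(α n (g * h)).1
      - (α n g).1 * (α n h).1‖ / d n) atTop (𝓝 0)) :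
    ∃ (A : ℕ → ℕ) (α' : (n : ℕ) → Γ →* Matrix.unitaryGroup (Fin (A n)) ℂ)
      (V : (n : ℕ) → Matrix (Fin (A n)) (Fin (d n) × Fin (d n)) ℂ),
      (∀ n, (V n)ᴴ * V n = 1) ∧ ∀ g, Tendsto (fun n => ‖V n * (α n g).1 * (V n)ᴴ
        - (α' n g).1‖ / d n) atTop (𝓝 0) := by
  let w : (n : ℕ) → Matrix (Fin (d n * d n)) (Fin (d n) × Fin (d n)) ℂ := fun n =>
    (1 : Matrix (Fin (d n) × Fin (d n)) (Fin (d n) × Fin (d n)) ℂ).submatrix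
      finProdFinEquiv.symm id
  have hw₁ : ∀ n, (w n)ᴴ * w n = 1 := fun n => by
    simp only [w, conjTranspose_submatrix, conjTranspose_one]
    rw [submatrix_mul_equiv _ _ _ finProdFinEquiv.symm]
    simp
  have hw₂ : ∀ n, w n * (w n)ᴴ = 1 := fun n => by
    simp only [w, conjTranspose_submatrix, conjTranspose_one]
    rw [← submatrix_mul _ _ _ _ _ Function.bijective_id]
    simp
  have hwn : ∀ n (x : Matrix (Fin (d n) × Fin (d n)) (Fin (d n) × Fin (d n)) ℂ),
      ‖w n * x * (w n)ᴴ‖ = ‖x‖ := fun n x => by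
    rw [norm_mul_coisometry (by simpa using hw₁ n), norm_isometry_mul (hw₁ n)]
  obtain ⟨A, α', hA, hα'⟩ := hstab (fun n => d n * d n)
    (fun n g => conjUnitary (w n) (hw₁ n) (hw₂ n) (α n g)) fun g h => by
      refine (hα g h).congr fun n => ?_
      rw [hsNorm_eq]
      simp only [conjUnitary, Nat.cast_mul]
      rw [Real.sqrt_mul_self (by positivity)]
      congr 1
      rw [← hwn n]
      congr 1
      calc _ = w n * (α n (g * h)).1 * (w n)ᴴ
            - w n * ((α n g).1 * 1 * (α n h).1) * (w n)ᴴ := by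
            rw [Matrix.mul_one, Matrix.mul_sub, Matrix.sub_mul]
        _ = _ := by
            rw [← hw₁ n]
            simp only [Matrix.mul_assoc]
  have hV : ∀ n, (padIsometry (A n) (d n * d n) * w n)ᴴ
      * (padIsometry (A n) (d n * d n) * w n) = 1 := fun n => by
    calc _ = (w n)ᴴ * ((padIsometry (A n) (d n * d n))ᴴ * padIsometry (A n) (d n * d n)) * w n := by
          simp only [conjTranspose_mul, Matrix.mul_assoc]
      _ = 1 := by rw [padIsometry_conjTranspose_mul (hA n), Matrix.mul_one, hw₁]
  refine ⟨A, α', fun n => padIsometry (A n) (d n * d n) * w n, hV, fun g => ?_⟩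
  set V := fun n => padIsometry (A n) (d n * d n) * w n
  have hdist : ∀ n, hsDist (conjUnitary (w n) (hw₁ n) (hw₂ n) (α n g)).1
      (α' n g).1 * Real.sqrt (A n)
      = ‖V n * (α n g).1 * (V n)ᴴ - (α' n g).1‖ := fun n => by
    rw [hsDist, ← norm_eq_hsNorm_mul, zeroPad_eq]
    simp only [conjUnitary, V, conjTranspose_mul, Matrix.mul_assoc]
  have h2 := (hα' g).const_mul 2
  rw [mul_zero] at h2
  refine squeeze_zero' (Eventually.of_forall fun n => by positivity) ?_ h2
  filter_upwards [(hα' g).eventually_le_const (by norm_num : (0 : ℝ) < 1 / 2)] with n hn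
  set t := hsDist (conjUnitary (w n) (hw₁ n) (hw₂ n) (α n g)).1
      (α' n g).1
  have ht : 0 ≤ t := Real.sqrt_nonneg _
  rw [← hdist]
  refine div_le_of_le_mul₀ (by positivity) (by positivity) ?_
  -- Comparing norms of unitaries bounds the dimension growth: once `t ≤ 1/2`, `√(A n) ≤ 2 d n`.
  -- Normalising by `d n` instead of `√(A n)` therefore costs only a factor `2`.
  have h3 : Real.sqrt (A n) ≤ d n + t * Real.sqrt (A n) := by
    have e1 : ‖V n * (α n g).1 * (V n)ᴴ‖ = d n := by
      rw [norm_mul_coisometry (by rw [conjTranspose_conjTranspose]; exact hV n), norm_isometry_mul (hV n), norm_unitary]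
      simp
    have e2 : ‖(α' n g).1‖ = Real.sqrt (A n) := by
      rw [norm_unitary]; simp
    have h := norm_le_norm_add_norm_sub' (α' n g).1 (V n * (α n g).1 * (V n)ᴴ)
    rwa [norm_sub_rev, ← hdist, e1, e2] at h
  nlinarith [Real.sqrt_nonneg (A n : ℝ), mul_nonneg (Real.sqrt_nonneg (A n : ℝ)) (sub_nonneg.2 hn)]

end Stability

/-! ### Unitaries of a corner. -/

section Corner

variable {d : ℕ} {q u : Matrix (Fin d) (Fin d) ℂ}

theorem mul_eq_of_mem_cornerUnitary (hq : IsStarProjection q) (hu : u ∈ cornerUnitary q) :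
    q * u = u := by
  conv_lhs => rw [← hu.1]
  rw [← Matrix.mul_assoc, ← Matrix.mul_assoc, hq.isIdempotentElem.eq, hu.1]

theorem eq_mul_of_mem_cornerUnitary (hq : IsStarProjection q) (hu : u ∈ cornerUnitary q) :
    u * q = u := by
  conv_lhs => rw [← hu.1]
  rw [Matrix.mul_assoc, hq.isIdempotentElem.eq, hu.1]

/-- The extension `u + (1 - q)` of a unitary of a corner to a unitary matrix. -/
theorem add_one_sub_mem_unitaryGroup {n : Type*} [Fintype n] [DecidableEq n]
    {q u : Matrix n n ℂ} (hq : IsStarProjection q) (huq : u * q = u)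
    (hu : u * star u = q) : u + (1 - q) ∈ Matrix.unitaryGroup n ℂ := by
  have hs : star q = q := hq.isSelfAdjoint
  have hi : q * q = q := hq.isIdempotentElem
  have h1 : q * star u = star u := by
    conv_rhs => rw [← huq, star_mul, hs]
  rw [Matrix.mem_unitaryGroup_iff, star_add, star_sub, star_one, hs]
  simp only [Matrix.add_mul, Matrix.mul_add, Matrix.sub_mul, Matrix.mul_sub, Matrix.one_mul,
    Matrix.mul_one, hu, h1, hi, huq]
  abel

theorem norm_eq_of_mem_cornerUnitary (hq : IsStarProjection q) (hu : u ∈ cornerUnitary q) :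
    ‖u‖ = ‖q‖ := by
  have hs : qᴴ = q := hq.isSelfAdjoint
  have h : ‖u‖ ^ 2 = ‖q‖ ^ 2 := by
    rw [← re_trace_conjTranspose_mul_self, ← re_trace_conjTranspose_mul_self,
      ← star_eq_conjTranspose, hu.2.1, hs, hq.isIdempotentElem.eq]
  exact (sq_eq_sq₀ (norm_nonneg _) (norm_nonneg _)).1 h

/-- A unitary of the corner that is close to the compression of `v` is close to `q v`. -/
theorem norm_sub_projection_mul_sq_le (hq : IsStarProjection q) (hu : u ∈ cornerUnitary q)
    (v : Matrix.unitaryGroup (Fin d) ℂ) {ε : ℝ}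
    (h : ‖u - q * v.1 * q‖ ≤ ε * ‖q‖) : ‖u - q * v.1‖ ^ 2 ≤ 2 * ε * ‖q‖ ^ 2 := by
  have hs : qᴴ = q := hq.isSelfAdjoint
  have hun := norm_eq_of_mem_cornerUnitary hq hu
  have hqv : ‖q * v.1‖ = ‖q‖ := norm_mul_unitary v q
  -- Because `u = u q`, the inner product does not see the missing right factor `q`. As `u` and `q
  -- v` both have norm `‖q‖`, it alone determines their distance.
  have h1 : inner ℂ u (q * v.1) = inner ℂ u (q * v.1 * q) := by
    conv_lhs => rw [← eq_mul_of_mem_cornerUnitary hq hu]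
    rw [inner_mul_right_eq, hs]
  have h2 : inner ℂ u (q * v.1 * q) = inner ℂ u u - inner ℂ u (u - q * v.1 * q) := by
    rw [inner_sub_right]; abel
  have h3 : (inner ℂ u (u - q * v.1 * q)).re ≤ ε * ‖q‖ ^ 2 := by
    calc _ ≤ ‖u‖ * ‖u - q * v.1 * q‖ := (Complex.re_le_norm _).trans (norm_inner_le_norm _ _)
      _ ≤ ‖q‖ * (ε * ‖q‖) := by rw [hun]; gcongr
      _ = _ := by ring
  have h4 : (inner ℂ u u).re = ‖q‖ ^ 2 := by rw [← hun]; exact inner_self_eq_norm_sq (𝕜 := ℂ) u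
  rw [@norm_sub_sq ℂ, hun, hqv, h1, h2, RCLike.re_to_complex, Complex.sub_re, h4]
  linarith

theorem norm_projection_le (hq : IsStarProjection q) : ‖q‖ ≤ Real.sqrt d := by
  have h := norm_projection_mul_le hq (1 : Matrix (Fin d) (Fin d) ℂ)
  have h1 := norm_unitary (1 : Matrix.unitaryGroup (Fin d) ℂ)
  rw [Fintype.card_fin] at h1
  rwa [Matrix.mul_one, ← h1] at *

end Corner

/-- On `ℂᵈ ⊗ ℂᵈ`, of dimension `d²`, normalising means dividing by `d`. Doubling thus at most
doubles a normalised error. -/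
theorem norm_conjKronecker_sub_div_le {d : ℕ} {a b : Matrix (Fin d) (Fin d) ℂ}
    (ha : ‖a‖ ≤ Real.sqrt d) (hb : ‖b‖ ≤ Real.sqrt d) :
    ‖conjKronecker a a - conjKronecker b b‖ / d ≤ 2 * (‖a - b‖ / Real.sqrt d) := by
  rcases Nat.eq_zero_or_pos d with rfl | hd
  · simp
  have hd' : (0 : ℝ) < d := by exact_mod_cast hd
  rw [div_le_iff₀ hd']
  calc _ ≤ ‖a - b‖ * (‖a‖ + ‖b‖) := norm_conjKronecker_sub_le a b
    _ ≤ ‖a - b‖ * (Real.sqrt d + Real.sqrt d) := by gcongr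
    _ = 2 * (‖a - b‖ / Real.sqrt d) * (Real.sqrt d * Real.sqrt d) := by
        field_simp
        ring
    _ = _ := by rw [Real.mul_self_sqrt hd'.le]

/-! ### Extended tensor squares and the almost invariant line. -/

section Rigidity

variable {Γ : Type*} [Group Γ]

/-- The extension of a unitary of the corner at `q` by the identity of the complement. -/
noncomputable def extendUnitary {d : ℕ} {q : Matrix (Fin d) (Fin d) ℂ} (hq : IsStarProjection q)
    (u : cornerUnitary q) : Matrix.unitaryGroup (Fin d) ℂ :=
  ⟨u.1 + (1 - q), add_one_sub_mem_unitaryGroup hq (eq_mul_of_mem_cornerUnitary hq u.2) u.2.2.2⟩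

theorem mul_extendUnitary {d : ℕ} {q : Matrix (Fin d) (Fin d) ℂ} (hq : IsStarProjection q)
    (u : cornerUnitary q) : q * (extendUnitary hq u).1 = u.1 := by
  rw [extendUnitary, Matrix.mul_add, mul_eq_of_mem_cornerUnitary hq u.2, Matrix.mul_sub,
    Matrix.mul_one, hq.isIdempotentElem.eq, sub_self, add_zero]

theorem extendUnitary_mul {d : ℕ} {q : Matrix (Fin d) (Fin d) ℂ} (hq : IsStarProjection q)
    (u : cornerUnitary q) : (extendUnitary hq u).1 * q = u.1 := by
  rw [extendUnitary, Matrix.add_mul, eq_mul_of_mem_cornerUnitary hq u.2, Matrix.sub_mul,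
    Matrix.one_mul, hq.isIdempotentElem.eq, sub_self, add_zero]

/-- The extension of `u ⊗ ū` by the identity of the complement of `q ⊗ q̄`. -/
noncomputable def tensorUnitary {d : ℕ} {q : Matrix (Fin d) (Fin d) ℂ} (hq : IsStarProjection q)
    (u : cornerUnitary q) : Matrix.unitaryGroup (Fin d × Fin d) ℂ :=
  ⟨conjKronecker u.1 u.1 + (1 - conjKronecker q q),
    add_one_sub_mem_unitaryGroup (isStarProjection_conjKronecker hq)
      (by rw [← conjKronecker_mul, eq_mul_of_mem_cornerUnitary hq u.2])
      (by rw [star_eq_conjTranspose, conjTranspose_conjKronecker, ← conjKronecker_mul,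
        ← star_eq_conjTranspose, u.2.2.2])⟩

theorem projection_mul_tensorUnitary {d : ℕ} {q : Matrix (Fin d) (Fin d) ℂ}
    (hq : IsStarProjection q) (u : cornerUnitary q) :
    conjKronecker q q * (tensorUnitary hq u).1 = conjKronecker u.1 u.1 := by
  have hQ := (isStarProjection_conjKronecker hq).isIdempotentElem.eq
  rw [tensorUnitary, Matrix.mul_add, ← conjKronecker_mul, mul_eq_of_mem_cornerUnitary hq u.2,
    Matrix.mul_sub, Matrix.mul_one, hQ, sub_self, add_zero]

theorem tensorUnitary_mul_projection {d : ℕ} {q : Matrix (Fin d) (Fin d) ℂ}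
    (hq : IsStarProjection q) (u : cornerUnitary q) :
    (tensorUnitary hq u).1 * conjKronecker q q = conjKronecker u.1 u.1 := by
  have hQ := (isStarProjection_conjKronecker hq).isIdempotentElem.eq
  rw [tensorUnitary, Matrix.add_mul, ← conjKronecker_mul, eq_mul_of_mem_cornerUnitary hq u.2,
    Matrix.sub_mul, Matrix.one_mul, hQ, sub_self, add_zero]

theorem tensorUnitary_mul {d : ℕ} {q : Matrix (Fin d) (Fin d) ℂ}
    (hq : IsStarProjection q) (u v : cornerUnitary q) :
    (tensorUnitary hq u).1 * (tensorUnitary hq v).1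
      = conjKronecker (u.1 * v.1) (u.1 * v.1) + (1 - conjKronecker q q) := by
  conv_lhs => rw [tensorUnitary, Matrix.add_mul]
  have h : (1 - conjKronecker q q) * (tensorUnitary hq v).1 = 1 - conjKronecker q q := by
    rw [Matrix.sub_mul, projection_mul_tensorUnitary, tensorUnitary]
    simp
  rw [h]
  congr 1
  conv_lhs => rw [← eq_mul_of_mem_cornerUnitary hq u.2, conjKronecker_mul, Matrix.mul_assoc,
    projection_mul_tensorUnitary]
  rw [← conjKronecker_mul]

/-- The unitary `v ⊗ v̄`. -/
noncomputable def squareUnitary {d : ℕ} (v : Matrix.unitaryGroup (Fin d) ℂ) :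
    Matrix.unitaryGroup (Fin d × Fin d) ℂ :=
  ⟨conjKronecker v.1 v.1, by
    rw [Matrix.mem_unitaryGroup_iff, star_eq_conjTranspose, conjTranspose_conjKronecker,
      ← conjKronecker_mul, unitary_mul_conjTranspose, conjKronecker_one]⟩

variable {d : ℕ} {q : Matrix (Fin d) (Fin d) ℂ}

/-- Displacement `lam / (16 K)` on `F` becomes `lam / 16` on `S`; the gap turns it into distance
`1/16`, and the passage to contractions into `1/8`, all relative to `‖q‖²`. This is the tolerance of
`exists_almost_invariant_line`. -/
theorem exists_line_of_close {S F : Finset Γ} (hS : ∀ s ∈ S, s⁻¹ ∈ S)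
    (hgen : Subgroup.closure (S : Set Γ) = ⊤) {lam : ℝ} (hlam : 0 < lam)
    (hgap : ∀ (d : ℕ) (π : Γ →* Matrix.unitaryGroup (Fin d) ℂ),
        spectrum ℝ (laplacian S π) ∩ Set.Ioo 0 lam = ∅) {K : ℝ} (hK : 0 < K)
    (hF : ∀ (E : Type) [NormedAddCommGroup E] [InnerProductSpace ℂ E] (U : Γ →* (E ≃ₗᵢ[ℂ] E))
        (x : E) (δ : ℝ), 0 ≤ δ → (∀ s ∈ F, ‖U s x - x‖ ≤ δ) → ∀ t ∈ S, ‖U t x - x‖ ≤ K * δ)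
    (hq : IsStarProjection q) (hq0 : q ≠ 0) (π : Γ → cornerUnitary q)
    (ρ : Γ → Matrix.unitaryGroup (Fin d) ℂ) {A B : ℕ} (α' : Γ →* Matrix.unitaryGroup (Fin A) ℂ)
    (β' : Γ →* Matrix.unitaryGroup (Fin B) ℂ) {V : Matrix (Fin A) (Fin d × Fin d) ℂ}
    {W : Matrix (Fin B) (Fin d × Fin d) ℂ} (hV : Vᴴ * V = 1) (hW : Wᴴ * W = 1) {η : Γ → ℝ}
    (hη : ∀ g, η g = ‖V * (tensorUnitary hq (π g)).1 * Vᴴ - (α' g).1‖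
      + ‖W * (squareUnitary (ρ g)).1 * Wᴴ - (β' g).1‖)
    (hclose : ∀ s ∈ F, 2 * ‖q‖ * ‖(π s).1 - q * (ρ s).1‖ + η s ≤ lam / (16 * K) * ‖q‖ ^ 2) :
    ∃ ξ : Matrix (Fin d) (Fin d) ℂ, ‖ξ‖ = 1 ∧ 3 / 4 * ‖q‖ ^ 2 ≤ ‖(inner ℂ q ξ : ℂ)‖ ^ 2 ∧
      ∀ g, ∃ b : ℂ, ‖(extendUnitary hq (π g)).1 * ξ * (ρ g).1ᴴ - b • ξ‖ ^ 2
        ≤ 2 * (η g / ‖q‖ ^ 2) := by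
  have hQ := isStarProjection_conjKronecker hq
  have hmove : ∀ s ∈ F, ‖bimoduleAction α' β' s (V * conjKronecker q q * Wᴴ)
      - V * conjKronecker q q * Wᴴ‖ ≤ lam / (16 * K) * ‖q‖ ^ 2 := fun s hs => by
    refine (norm_bimoduleAction_compression_sub_le (α := fun g => (tensorUnitary hq (π g)).1)
      (β := fun g => (squareUnitary (ρ g)).1) hV hW hQ s).trans (le_trans ?_ (hclose s hs))
    rw [hη, tensorUnitary_mul_projection]
    gcongr
    rw [squareUnitary, ← conjKronecker_mul]
    refine (norm_conjKronecker_sub_le _ _).trans (le_of_eq ?_)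
    rw [norm_eq_of_mem_cornerUnitary hq (π s).2, norm_mul_unitary (ρ s) q]
    ring
  obtain ⟨y, hyQ, hy⟩ := exists_almost_intertwiner (α := fun g => (tensorUnitary hq (π g)).1)
    (β := fun g => (squareUnitary (ρ g)).1) hS hgen hlam hgap hV hW hQ
    (mul_nonneg hK.le (by positivity)) (hF _ (bimoduleAction α' β') _ _ (by positivity) hmove)
  -- The tensor square of `extendUnitary` differs from `tensorUnitary` off `Q`. Multiplying `y` by
  -- `Q` on the left keeps only the part where both are `π ⊗ π̄`.
  refine exists_almost_invariant_line hq0 (fun g => extendUnitary hq (π g)) ρ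
    (z := conjKronecker q q * y) ?_ fun g => ?_
  · calc _ = ‖conjKronecker q q * (y - conjKronecker q q)‖ := by
          rw [Matrix.mul_sub, hQ.isIdempotentElem.eq]
      _ ≤ 2 * (K * (lam / (16 * K) * ‖q‖ ^ 2) / lam) := (norm_projection_mul_le hQ _).trans hyQ
      _ = _ := by field_simp; ring
  · rw [hη]
    refine le_trans ?_ (hy g)
    have h1 : conjKronecker (extendUnitary hq (π g)).1 (extendUnitary hq (π g)).1
        * (conjKronecker q q * y) = conjKronecker q q * ((tensorUnitary hq (π g)).1 * y) := by
      rw [← Matrix.mul_assoc, ← Matrix.mul_assoc, projection_mul_tensorUnitary,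
        ← conjKronecker_mul, extendUnitary_mul]
    rw [h1, Matrix.mul_assoc, ← Matrix.mul_sub]
    exact norm_projection_mul_le hQ _

end Rigidity

theorem IsAsymptoticRep.tendsto_squareUnitary {Γ : Type*} [Group Γ] {d : ℕ → ℕ}
    {ρ : (n : ℕ) → Γ → Matrix.unitaryGroup (Fin (d n)) ℂ} (hρ : IsAsymptoticRep ρ) (g h : Γ) :
    Tendsto (fun n => ‖(squareUnitary (ρ n (g * h))).1
      - (squareUnitary (ρ n g)).1 * (squareUnitary (ρ n h)).1‖ / d n) atTop (𝓝 0) := by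
  have h2 := (hρ g h).const_mul 2
  rw [mul_zero] at h2
  refine squeeze_zero (fun n => by positivity) (fun n => ?_) h2
  have hn : ∀ u : Matrix.unitaryGroup (Fin (d n)) ℂ, ‖u.1‖ ≤ Real.sqrt (d n) := fun u => by
    rw [norm_unitary, Fintype.card_fin]
  rw [hsNorm_eq]
  simp only [squareUnitary]
  rw [← conjKronecker_mul]
  exact norm_conjKronecker_sub_div_le (hn _) (hn (ρ n g * ρ n h))

/-- The cocycle disappears because `c c̄ = 1`. The extension must be by the identity off `q ⊗ q̄`:
in the tensor square of `u + (1 - q)` the cross terms `u ⊗ (1 - q)` would still carry `c`. -/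
theorem tendsto_tensorUnitary {Γ : Type*} [Group Γ] {d : ℕ → ℕ}
    {q : (n : ℕ) → Matrix (Fin (d n)) (Fin (d n)) ℂ} (hq : ∀ n, IsStarProjection (q n))
    (π : (n : ℕ) → Γ → cornerUnitary (q n)) (c : Γ → Γ → Circle) (g h : Γ)
    (hπ : Tendsto (fun n => ‖(π n g).1 * (π n h).1 - (c g h : ℂ) • (π n (g * h)).1‖
      / Real.sqrt (d n)) atTop (𝓝 0)) :
    Tendsto (fun n => ‖(tensorUnitary (hq n) (π n (g * h))).1
      - (tensorUnitary (hq n) (π n g)).1 * (tensorUnitary (hq n) (π n h)).1‖ / d n)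
      atTop (𝓝 0) := by
  have h2 := hπ.const_mul 2
  rw [mul_zero] at h2
  refine squeeze_zero (fun n => by positivity) (fun n => ?_) h2
  have hn : ∀ u : cornerUnitary (q n), ‖u.1‖ ≤ Real.sqrt (d n) := fun u => by
    rw [norm_eq_of_mem_cornerUnitary (hq n) u.2]
    exact norm_projection_le (hq n)
  have hc : conjKronecker (π n (g * h)).1 (π n (g * h)).1
      = conjKronecker ((c g h : ℂ) • (π n (g * h)).1) ((c g h : ℂ) • (π n (g * h)).1) := by
    rw [conjKronecker_smul, Complex.mul_conj, Complex.normSq_eq_norm_sq, Circle.norm_coe]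
    simp
  rw [tensorUnitary_mul, tensorUnitary, add_sub_add_right_eq_sub, hc, norm_sub_rev]
  refine norm_conjKronecker_sub_div_le ?_ ?_
  · have h3 : (π n g).1 * (π n h).1 = (π n g).1 * (extendUnitary (hq n) (π n h)).1 := by
      rw [← eq_mul_of_mem_cornerUnitary (hq n) (π n g).2, Matrix.mul_assoc, Matrix.mul_assoc,
        mul_extendUnitary, mul_eq_of_mem_cornerUnitary (hq n) (π n h).2]
    rw [h3, norm_mul_unitary]
    exact hn _
  · rw [norm_smul, Circle.norm_coe, one_mul]
    exact hn _

/-- Lines that are asymptotically invariant under `x ↦ π(g) x ρ(g)ᴴ` exhibit the cocycle of `π` as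
a coboundary. -/
theorem isTwoCoboundary_of_lines {Γ : Type*} [Group Γ] {d : ℕ → ℕ}
    {q : (n : ℕ) → Matrix (Fin (d n)) (Fin (d n)) ℂ} (hq : ∀ n, IsStarProjection (q n))
    {κ : ℝ} (hκ : 0 < κ) (hqκ : ∀ᶠ n in atTop, 0 < d n ∧ κ * Real.sqrt (d n) ≤ ‖q n‖)
    {ρ : (n : ℕ) → Γ → Matrix.unitaryGroup (Fin (d n)) ℂ} (hρ : IsAsymptoticRep ρ)
    (π : (n : ℕ) → Γ → cornerUnitary (q n)) (c : Γ → Γ → Circle)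
    (hπ : ∀ g h, Tendsto (fun n => ‖(π n g).1 * (π n h).1 - (c g h : ℂ) • (π n (g * h)).1‖
      / Real.sqrt (d n)) atTop (𝓝 0))
    (ξ : (n : ℕ) → Matrix (Fin (d n)) (Fin (d n)) ℂ) (b : ℕ → Γ → ℂ)
    (hξ : ∀ᶠ n in atTop, ‖ξ n‖ = 1 ∧ 3 / 4 * ‖q n‖ ^ 2 ≤ ‖(inner ℂ (q n) (ξ n) : ℂ)‖ ^ 2)
    (hb : ∀ g, Tendsto (fun n => ‖(extendUnitary (hq n) (π n g)).1 * ξ n * (ρ n g).1ᴴ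
      - b n g • ξ n‖) atTop (𝓝 0)) :
    IsTwoCoboundary c := by
  have hb1 : ∀ g, Tendsto (fun n => ‖b n g‖) atTop (𝓝 1) := fun g => by
    rw [tendsto_iff_norm_sub_tendsto_zero]
    refine squeeze_zero' (Eventually.of_forall fun n => by positivity) ?_ (hb g)
    filter_upwards [hξ] with n hn
    have h := abs_norm_sub_norm_le (b n g • ξ n)
      ((extendUnitary (hq n) (π n g)).1 * ξ n * (ρ n g).1ᴴ)
    rwa [norm_mul_unitary_conjTranspose, norm_unitary_mul, norm_smul, hn.1, mul_one,
      norm_sub_rev (b n g • ξ n)] at h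
  refine isTwoCoboundary_of_tendsto b hb1 fun g h => ?_
  have hlim : Tendsto (fun n =>
      2 * ((‖(extendUnitary (hq n) (π n h)).1 * ξ n * (ρ n h).1ᴴ - b n h • ξ n‖
        + ‖b n h‖ * ‖(extendUnitary (hq n) (π n g)).1 * ξ n * (ρ n g).1ᴴ - b n g • ξ n‖
        + ‖(extendUnitary (hq n) (π n (g * h))).1 * ξ n * (ρ n (g * h)).1ᴴ
            - b n (g * h) • ξ n‖)
      + κ⁻¹ * (‖(π n g).1 * (π n h).1 - (c g h : ℂ) • (π n (g * h)).1‖ / Real.sqrt (d n)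
        + hsNorm ((ρ n (g * h)).1 - (ρ n g).1 * (ρ n h).1)))) atTop (𝓝 0) := by
    have := ((((hb h).add ((hb1 h).mul (hb g))).add (hb (g * h))).add
      (((hπ g h).add (hρ g h)).const_mul κ⁻¹)).const_mul 2
    simpa using this
  refine squeeze_zero_norm' ?_ hlim
  filter_upwards [hξ, hqκ] with n hn hqn
  have hd : 0 < Real.sqrt (d n) := Real.sqrt_pos.2 (by exact_mod_cast hqn.1)
  have hq0 : 0 < ‖q n‖ := lt_of_lt_of_le (by positivity) hqn.2
  have key := norm_mul_sub_mul_inner_le (hq n) hn.1 (extendUnitary (hq n) (π n g))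
    (extendUnitary (hq n) (π n h)) (extendUnitary (hq n) (π n (g * h))) (ρ n g) (ρ n h)
    (ρ n (g * h)) (c g h) (b n g) (b n h) (b n (g * h))
  have hX : q n * ((extendUnitary (hq n) (π n g)).1 * (extendUnitary (hq n) (π n h)).1)
      = (π n g).1 * (π n h).1 := by
    rw [← Matrix.mul_assoc, mul_extendUnitary]
    conv_lhs => rw [← eq_mul_of_mem_cornerUnitary (hq n) (π n g).2, Matrix.mul_assoc,
      mul_extendUnitary]
  rw [hX, mul_extendUnitary] at key
  have hinner : 1 / 2 * ‖q n‖ ≤ ‖(inner ℂ (q n) (ξ n) : ℂ)‖ := by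
    refine le_of_sq_le_sq ?_ (norm_nonneg _)
    refine le_trans ?_ hn.2
    nlinarith [sq_nonneg ‖q n‖]
  rw [hsNorm_eq, ← add_div]
  set E₁ := ‖(extendUnitary (hq n) (π n h)).1 * ξ n * (ρ n h).1ᴴ - b n h • ξ n‖
        + ‖b n h‖ * ‖(extendUnitary (hq n) (π n g)).1 * ξ n * (ρ n g).1ᴴ - b n g • ξ n‖
        + ‖(extendUnitary (hq n) (π n (g * h))).1 * ξ n * (ρ n (g * h)).1ᴴ
            - b n (g * h) • ξ n‖
  set E₂ := ‖(π n g).1 * (π n h).1 - (c g h : ℂ) • (π n (g * h)).1‖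
        + ‖(ρ n (g * h)).1 - (ρ n g).1 * (ρ n h).1‖
  have hE₂ : E₂ ≤ κ⁻¹ * (E₂ / Real.sqrt (d n)) * ‖q n‖ := by
    have h0 : 0 ≤ E₂ := by positivity
    calc E₂ = κ⁻¹ * (E₂ / Real.sqrt (d n)) * (κ * Real.sqrt (d n)) := by field_simp
      _ ≤ _ := by gcongr; exact hqn.2
  have h1 : ‖b n g * b n h - c g h * b n (g * h)‖ * (1 / 2 * ‖q n‖)
      ≤ E₁ * ‖q n‖ + κ⁻¹ * (E₂ / Real.sqrt (d n)) * ‖q n‖ :=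
    (mul_le_mul_of_nonneg_left hinner (norm_nonneg _)).trans
      (key.trans (add_le_add le_rfl hE₂))
  refine le_of_mul_le_mul_right ?_ hq0
  linarith

end HSRigidity

attribute [local instance] Matrix.frobeniusNormedAddCommGroup Matrix.frobeniusNormedSpace
  HSRigidity.frobeniusInnerProductSpace

theorem theorem7p3 {Γ : Type*} [Group Γ] (S : Set Γ) (hS : Subgroup.closure S = ⊤)
    (hT : HSRigidity.HasPropertyTFD Γ) (hstab : HSRigidity.IsHilbertSchmidtStable Γ) :
    ∃ ε : ℝ, 0 < ε ∧
      ∀ (d : ℕ → ℕ) (q : (n : ℕ) → Matrix (Fin (d n)) (Fin (d n)) ℂ)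
        (ρ : (n : ℕ) → Γ → Matrix.unitaryGroup (Fin (d n)) ℂ)
        (π : (n : ℕ) → Γ → Matrix (Fin (d n)) (Fin (d n)) ℂ)
        (c : Γ → Γ → Circle),
        (∀ n, IsStarProjection (q n)) →
        0 < Filter.liminf (fun n => HSRigidity.hsNorm (q n)) Filter.atTop →
        HSRigidity.IsAsymptoticRep ρ →
        HSRigidity.IsAsymptoticallyProjectiveRep q π c →
        (∀ᶠ n in Filter.atTop, ∀ s ∈ S,
          HSRigidity.hsNorm
            (π n s - q n * (ρ n s : Matrix (Fin (d n)) (Fin (d n)) ℂ) * q n)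
            / HSRigidity.hsNorm (q n) < ε) →
        HSRigidity.IsTwoCoboundary c := by
  open HSRigidity in
  obtain ⟨S₀, hsymm, hgen, lam, hlam, hgap⟩ := hT
  obtain ⟨K, hK, F, hFS, hF⟩ := exists_uniform_displacement_bound hS S₀
  set τ : ℝ := lam / (64 * K) with hτ
  have hτ0 : 0 < τ := by positivity
  -- Closeness `ε` to `q ρ(s) q` gives only `√(2ε) = τ` to `q ρ(s)`. The displacement is then `2τ =
  -- lam / (32 K)`, leaving the other half of `lam / (16 K)` for the stability errors.
  refine ⟨τ ^ 2 / 2, by positivity, fun d q ρ π₀ c hq hlim hρ hπ₀ hclose => ?_⟩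
  let π : (n : ℕ) → Γ → cornerUnitary (q n) := fun n g => ⟨π₀ n g, hπ₀.mem_cornerUnitary n g⟩
  -- The positive liminf makes `‖q n‖` comparable to `√(d n)`, so errors relative to the corner and
  -- to the full matrix algebra agree up to constants.
  obtain ⟨κ, hκ, hκlim⟩ := exists_between hlim
  have hqκ : ∀ᶠ n in atTop, 0 < d n ∧ κ * Real.sqrt (d n) ≤ ‖q n‖ := by
    have hev := eventually_lt_of_lt_liminf hκlim
      (isBoundedUnder_of ⟨0, fun n => Real.sqrt_nonneg _⟩)
    filter_upwards [hev] with n hn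
    refine ⟨Nat.pos_of_ne_zero fun h0 => ?_, ?_⟩
    · have h1 : Real.sqrt (d n) = 0 := by simp [h0]
      rw [hsNorm_eq, h1, div_zero] at hn
      linarith
    · rw [norm_eq_hsNorm_mul]
      gcongr
  have hπ : ∀ g h, Tendsto (fun n => ‖(π n g).1 * (π n h).1 - (c g h : ℂ) • (π n (g * h)).1‖
      / Real.sqrt (d n)) atTop (𝓝 0) := fun g h => by
    refine squeeze_zero' (Eventually.of_forall fun n => by positivity) ?_ (hπ₀.tendsto g h)
    filter_upwards [hqκ] with n hn
    have hd : 0 < Real.sqrt (d n) := Real.sqrt_pos.2 (by exact_mod_cast hn.1)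
    have h0 : 0 < ‖q n‖ := lt_of_lt_of_le (by positivity) hn.2
    rw [cornerNorm, hsNorm_eq, hsNorm_eq, div_div_div_cancel_right₀ hd.ne']
    gcongr
    exact norm_projection_le (hq n)
  obtain ⟨A, α', V, hV, hVlim⟩ := hstab.exists_approx
    (fun n g => tensorUnitary (hq n) (π n g)) fun g h => tendsto_tensorUnitary hq π c g h (hπ g h)
  obtain ⟨B, β', W, hW, hWlim⟩ := hstab.exists_approx
    (fun n g => squareUnitary (ρ n g)) fun g h => hρ.tendsto_squareUnitary g h
  set η : ℕ → Γ → ℝ := fun n g => ‖V n * (tensorUnitary (hq n) (π n g)).1 * (V n).conjTranspose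
    - (α' n g).1‖ + ‖W n * (squareUnitary (ρ n g)).1 * (W n).conjTranspose - (β' n g).1‖ with hη
  have hηlim : ∀ g, Tendsto (fun n => η n g / ‖q n‖ ^ 2) atTop (𝓝 0) := fun g => by
    have h1 := ((hVlim g).add (hWlim g)).const_mul (κ ^ 2)⁻¹
    rw [add_zero, mul_zero] at h1
    refine squeeze_zero' (Eventually.of_forall fun n => by positivity) ?_ h1
    filter_upwards [hqκ] with n hn
    have hd : (0 : ℝ) < d n := by exact_mod_cast hn.1
    have h2 : κ ^ 2 * d n ≤ ‖q n‖ ^ 2 := by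
      calc κ ^ 2 * d n = (κ * Real.sqrt (d n)) ^ 2 := by rw [mul_pow, Real.sq_sqrt hd.le]
        _ ≤ _ := by gcongr; exact hn.2
    calc η n g / ‖q n‖ ^ 2 ≤ η n g / (κ ^ 2 * d n) := by gcongr
      _ = _ := by rw [← add_div, div_eq_mul_inv, mul_inv, div_eq_mul_inv]; ring
  have hlines : ∀ᶠ n in atTop, ∃ ξ : Matrix (Fin (d n)) (Fin (d n)) ℂ, ‖ξ‖ = 1 ∧
      3 / 4 * ‖q n‖ ^ 2 ≤ ‖(inner ℂ (q n) ξ : ℂ)‖ ^ 2 ∧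
      ∀ g, ∃ b : ℂ, ‖(extendUnitary (hq n) (π n g)).1 * ξ * (ρ n g).1.conjTranspose - b • ξ‖ ^ 2
        ≤ 2 * (η n g / ‖q n‖ ^ 2) := by
    have hsmall : ∀ᶠ n in atTop, ∀ s ∈ F, η n s / ‖q n‖ ^ 2 ≤ lam / (32 * K) :=
      (Filter.eventually_all_finset F).2 fun s _ =>
        (hηlim s).eventually_le_const (by positivity)
    filter_upwards [hqκ, hclose, hsmall] with n hn hcl hsm
    have hd : 0 < Real.sqrt (d n) := Real.sqrt_pos.2 (by exact_mod_cast hn.1)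
    have h0 : 0 < ‖q n‖ := lt_of_lt_of_le (by positivity) hn.2
    refine exists_line_of_close hsymm hgen hlam hgap hK hF (hq n) (norm_pos_iff.1 h0) (π n) (ρ n)
      (α' n) (β' n) (hV n) (hW n) (fun g => rfl) fun s hs => ?_
    have h1 := hcl s (hFS hs)
    rw [hsNorm_eq, hsNorm_eq, div_div_div_cancel_right₀ hd.ne', div_lt_iff₀ h0] at h1
    have h2 := norm_sub_projection_mul_sq_le (hq n) (π n s).2 (ρ n s) h1.le
    have h3 : ‖(π n s).1 - q n * (ρ n s).1‖ ≤ τ * ‖q n‖ := by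
      refine le_of_sq_le_sq ?_ (by positivity)
      linarith [mul_pow τ ‖q n‖ 2]
    have h4 := (div_le_iff₀ (by positivity)).1 (hsm s hs)
    calc 2 * ‖q n‖ * ‖(π n s).1 - q n * (ρ n s).1‖ + η n s
        ≤ 2 * ‖q n‖ * (τ * ‖q n‖) + lam / (32 * K) * ‖q n‖ ^ 2 := by gcongr
      _ = lam / (16 * K) * ‖q n‖ ^ 2 := by rw [hτ]; field_simp; ring
  -- Makes `ξ` and `b` total in `n`; the value `0` is used only at the finitely many `n` where no
  -- line is available.
  have hchoice : ∀ n, ∃ (ξ : Matrix (Fin (d n)) (Fin (d n)) ℂ) (b : Γ → ℂ),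
      (∃ ξ : Matrix (Fin (d n)) (Fin (d n)) ℂ, ‖ξ‖ = 1 ∧
        3 / 4 * ‖q n‖ ^ 2 ≤ ‖(inner ℂ (q n) ξ : ℂ)‖ ^ 2 ∧
        ∀ g, ∃ b : ℂ, ‖(extendUnitary (hq n) (π n g)).1 * ξ * (ρ n g).1.conjTranspose
          - b • ξ‖ ^ 2 ≤ 2 * (η n g / ‖q n‖ ^ 2)) →
      ‖ξ‖ = 1 ∧ 3 / 4 * ‖q n‖ ^ 2 ≤ ‖(inner ℂ (q n) ξ : ℂ)‖ ^ 2 ∧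
        ∀ g, ‖(extendUnitary (hq n) (π n g)).1 * ξ * (ρ n g).1.conjTranspose - b g • ξ‖ ^ 2
          ≤ 2 * (η n g / ‖q n‖ ^ 2) := fun n => by
    by_cases h : ∃ ξ : Matrix (Fin (d n)) (Fin (d n)) ℂ, ‖ξ‖ = 1 ∧
        3 / 4 * ‖q n‖ ^ 2 ≤ ‖(inner ℂ (q n) ξ : ℂ)‖ ^ 2 ∧
        ∀ g, ∃ b : ℂ, ‖(extendUnitary (hq n) (π n g)).1 * ξ * (ρ n g).1.conjTranspose
          - b • ξ‖ ^ 2 ≤ 2 * (η n g / ‖q n‖ ^ 2)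
    · obtain ⟨ξ, h1, h2, h3⟩ := h
      choose b hb using h3
      exact ⟨ξ, b, fun _ => ⟨h1, h2, hb⟩⟩
    · exact ⟨0, 0, fun h' => absurd h' h⟩
  choose ξ b hξb using hchoice
  have hξ := hlines.mono hξb
  refine isTwoCoboundary_of_lines hq hκ hqκ hρ π c hπ ξ b
    (hξ.mono fun n hn => ⟨hn.1, hn.2.1⟩) fun g => ?_
  have h1 : Tendsto (fun n => ‖(extendUnitary (hq n) (π n g)).1 * ξ n
      * (ρ n g).1.conjTranspose - b n g • ξ n‖ ^ 2) atTop (𝓝 0) := by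
    have h2 := (hηlim g).const_mul 2
    rw [mul_zero] at h2
    exact squeeze_zero' (Eventually.of_forall fun n => by positivity)
      (hξ.mono fun n hn => hn.2.2 g) h2
  simpa using h1.sqrt
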